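/- Let $\mathfrak g$ be a finite-dimensional real semisimple Lie algebra, and let $\mathfrak g^*$ be its dual, regarded as a smooth manifold, with $d_\xi f\in(\mathfrak g^*)^*=\mathfrak g$ the differential of $f\in C^\infty(\mathfrak g^*)$ at $\xi$. A bivector field $B$ on $\mathfrak g^*$ acts as the bidifferential operator $B(f,g)(\xi)=B_\xi(d_\xi f,d_\xi g)$ on $C^\infty(\mathfrak g^*)$. A *differential formal Poisson structure* on $\mathfrak g^*$ is a formal series $\beta=\sum_{i\ge 0}h^{i+1}\beta_i$ of smooth bivector fields $\beta_i$ on $\mathfrak g^*$ that satisfies the Jacobi identity order by order in $h$: for all $n\ge 0$ and $f,g,k\in C^\infty(\mathfrak g^*)$, $$\sum_{i+j=n}\bigl(\beta_i(f,\beta_j(g,k))+\beta_i(g,\beta_j(k,f))+\beta_i(k,\beta_j(f,g))\bigr)=0 .$$ It is *algebraic* if $\beta_i(p,q)$ is a polynomial function on $\mathfrak g^*$ for every $i$ and all polynomial functions $p,q$. The *Kirillov Poisson structure* is $\{f,g\}(\xi)=\langle\xi,[d_\xi f,d_\xi g]\rangle$. A vector field $Z$ acts on bilinear operators $B$ on $C^\infty(\mathfrak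 g^*)$ by $$(Z\cdot B)(f,g)=Z(B(f,g))-B(Z(f),g)-B(f,Z(g)),$$ and this action is extended $h$-bilinearly to formal series. Every algebraic differential formal Poisson structure $\beta=\sum_{i\ge 0}h^{i+1}\beta_i$ on $\mathfrak g^*$ such that $\beta_0$ is the Kirillov Poisson structure is gauge equivalent to $h\beta_0$ by a formal path in the diffeomorphism group of $\mathfrak g^*$ starting at the identity; that is, there is a formal series $Z=\sum_{n\ge1}h^nZ_n$ of smooth vector fields on $\mathfrak g^*$ such that $$\exp(Z)\cdot\beta:=\sum_{k\ge 0}\frac1{k!}\,\underbrace{Z\cdot(\cdots(Z}_{k}\cdot\,\beta))=h\beta_0 .$$ -/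

import Mathlib

open scoped Manifold ContDiff

noncomputable section

namespace KirillovDeformation

section DualSpace

variable (V : Type*) [AddCommGroup V] [Module ℝ V] [FiniteDimensional ℝ V]

/-- The coordinates of a functional with respect to a (chosen) basis of `V`. -/
def dualCoord : Module.Dual ℝ V →ₗ[ℝ] (Fin (Module.finrank ℝ V) → ℝ) :=
  LinearMap.pi fun i => Module.Dual.eval ℝ V (Module.finBasis ℝ V i)

theorem dualCoord_injective : Function.Injective (dualCoord V) := by
  intro f g h
  refine (Module.finBasis ℝ V).ext fun i => ?_
  exact congrFun h i

/-- The dual `V^*` of a finite-dimensional real vector space, as a normed space.  The norm is read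
off in coordinates; as all norms on `V^*` are equivalent, the topology, the differential calculus
and the smooth structure do not depend on the choice of the basis. -/
instance dualNormedAddCommGroup : NormedAddCommGroup (Module.Dual ℝ V) :=
  NormedAddCommGroup.induced (Module.Dual ℝ V) (Fin (Module.finrank ℝ V) → ℝ) (dualCoord V)
    (dualCoord_injective V)

instance dualNormedSpace : NormedSpace ℝ (Module.Dual ℝ V) :=
  NormedSpace.induced ℝ (Module.Dual ℝ V) (Fin (Module.finrank ℝ V) → ℝ) (dualCoord V)

/-- The algebra `C^∞(V^*)` of real-valued smooth functions on `V^*`. -/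
abbrev SmoothFun : Type _ := C^∞⟮𝓘(ℝ, Module.Dual ℝ V), Module.Dual ℝ V; ℝ⟯

end DualSpace

section PolyvectorFields

variable {V : Type*} [AddCommGroup V] [Module ℝ V] [FiniteDimensional ℝ V]

theorem SmoothFun.contDiff (f : SmoothFun V) : ContDiff ℝ ∞ (f : Module.Dual ℝ V → ℝ) :=
  contMDiff_iff_contDiff.1 f.contMDiff

theorem SmoothFun.differentiable (f : SmoothFun V) :
    Differentiable ℝ (f : Module.Dual ℝ V → ℝ) :=
  f.contDiff.differentiable (by simp)

/-- Make an element of `C^∞(V^*)` from a smooth function. -/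
def SmoothFun.mk (f : Module.Dual ℝ V → ℝ) (hf : ContDiff ℝ ∞ f) : SmoothFun V :=
  ⟨f, contMDiff_iff_contDiff.2 hf⟩

theorem contDiff_eval (X : V) : ContDiff ℝ ∞ (fun ξ : Module.Dual ℝ V => ξ X) :=
  (LinearMap.toContinuousLinearMap (Module.Dual.eval ℝ V X)).contDiff

/-- The linear function `ξ ↦ ξ X` on `V^*` given by `X ∈ V`. -/
def linearFun (X : V) : SmoothFun V := SmoothFun.mk (fun ξ => ξ X) (contDiff_eval X)

variable (V) in
/-- The algebra `Pol(V^*) ≅ Sym(V)` of polynomial functions on `V^*`, inside `C^∞(V^*)`. -/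
def polynomialFun : Subalgebra ℝ (SmoothFun V) := Algebra.adjoin ℝ (Set.range linearFun)

/-- The differential `d_ξ f` of a smooth function at a point `ξ` of `V^*`.  It is a cotangent
vector at `ξ`, that is, an element of `V^** = V`. -/
def differential (f : SmoothFun V) (ξ : Module.Dual ℝ V) : V :=
  (Module.evalEquiv ℝ V).symm (fderiv ℝ (f : Module.Dual ℝ V → ℝ) ξ).toLinearMap

/-- The defining property of `d_ξ f`: its pairing with a tangent vector is the derivative of `f`
in that direction. -/
theorem apply_differential (f : SmoothFun V) (ξ η : Module.Dual ℝ V) :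
    η (differential f ξ) = fderiv ℝ (f : Module.Dual ℝ V → ℝ) ξ η :=
  Module.apply_evalEquiv_symm_apply _ _ η _

theorem differential_add (f g : SmoothFun V) (ξ : Module.Dual ℝ V) :
    differential (f + g) ξ = differential f ξ + differential g ξ := by
  have h : fderiv ℝ ((f + g : SmoothFun V) : Module.Dual ℝ V → ℝ) ξ =
      fderiv ℝ (f : Module.Dual ℝ V → ℝ) ξ + fderiv ℝ (g : Module.Dual ℝ V → ℝ) ξ :=
    fderiv_add (f.differentiable ξ) (g.differentiable ξ)
  simp only [differential, h, ContinuousLinearMap.toLinearMap_add, map_add]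

theorem differential_smul (c : ℝ) (f : SmoothFun V) (ξ : Module.Dual ℝ V) :
    differential (c • f) ξ = c • differential f ξ := by
  have h : fderiv ℝ ((c • f : SmoothFun V) : Module.Dual ℝ V → ℝ) ξ =
      c • fderiv ℝ (f : Module.Dual ℝ V → ℝ) ξ :=
    fderiv_const_smul (f.differentiable ξ) c
  simp only [differential, h, ContinuousLinearMap.toLinearMap_smul, map_smul]

/-- The differential in coordinates. -/
theorem differential_eq_sum (f : SmoothFun V) (ξ : Module.Dual ℝ V) :
    differential f ξ = ∑ i, (fderiv ℝ (f : Module.Dual ℝ V → ℝ) ξ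
      ((Module.finBasis ℝ V).coord i)) • Module.finBasis ℝ V i := by
  conv_lhs => rw [← (Module.finBasis ℝ V).sum_repr (differential f ξ)]
  refine Finset.sum_congr rfl fun i _ => ?_
  rw [← apply_differential, Module.Basis.coord_apply]

theorem contDiff_fderiv_apply (f : SmoothFun V) {Z : Module.Dual ℝ V → Module.Dual ℝ V}
    (hZ : ContDiff ℝ ∞ Z) :
    ContDiff ℝ ∞ (fun ξ => fderiv ℝ (f : Module.Dual ℝ V → ℝ) ξ (Z ξ)) :=
  (f.contDiff.fderiv_right (m := ∞) (by simp)).clm_apply hZ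

variable (V) in
/-- A smooth vector field on `V^*`: a smooth map that assigns to every point `ξ` a tangent vector
at `ξ`, that is, an element of `V^*`. -/
structure VectorField where
  toFun : Module.Dual ℝ V → Module.Dual ℝ V
  contDiff_toFun : ContDiff ℝ ∞ toFun

instance : Zero (VectorField V) := ⟨⟨fun _ => 0, contDiff_const⟩⟩

/-- The action of a vector field on smooth functions, `Z(f)(ξ) = (d_ξ f)(Z_ξ)`. -/
def VectorField.act (Z : VectorField V) : SmoothFun V →ₗ[ℝ] SmoothFun V where
  toFun f := SmoothFun.mk (fun ξ => fderiv ℝ (f : Module.Dual ℝ V → ℝ) ξ (Z.toFun ξ))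
    (contDiff_fderiv_apply f Z.contDiff_toFun)
  map_add' f g := by
    ext ξ
    change fderiv ℝ ((f : Module.Dual ℝ V → ℝ) + (g : Module.Dual ℝ V → ℝ)) ξ (Z.toFun ξ) =
      fderiv ℝ (f : Module.Dual ℝ V → ℝ) ξ (Z.toFun ξ) +
        fderiv ℝ (g : Module.Dual ℝ V → ℝ) ξ (Z.toFun ξ)
    rw [fderiv_add (f.differentiable ξ) (g.differentiable ξ)]
    rfl
  map_smul' c f := by
    ext ξ
    change fderiv ℝ (c • (f : Module.Dual ℝ V → ℝ)) ξ (Z.toFun ξ) =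
      c * fderiv ℝ (f : Module.Dual ℝ V → ℝ) ξ (Z.toFun ξ)
    rw [fderiv_const_smul (f.differentiable ξ) c]
    rfl

variable (V) in
/-- A smooth bivector field on `V^*`: for every point `ξ` an alternating bilinear form on the
cotangent space `V` at `ξ`, with coefficients that depend smoothly on `ξ`. -/
structure BivectorField where
  toFun : Module.Dual ℝ V → V →ₗ[ℝ] V →ₗ[ℝ] ℝ
  isAlt : ∀ ξ, (toFun ξ).IsAlt
  contDiff_toFun : ∀ X Y : V, ContDiff ℝ ∞ (fun ξ => toFun ξ X Y)

instance : Zero (BivectorField V) :=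
  ⟨⟨fun _ => 0, fun _ _ => rfl, fun _ _ => contDiff_const⟩⟩

theorem BivectorField.contDiff_apply (B : BivectorField V) (f g : SmoothFun V) :
    ContDiff ℝ ∞ (fun ξ => B.toFun ξ (differential f ξ) (differential g ξ)) := by
  have h : (fun ξ => B.toFun ξ (differential f ξ) (differential g ξ)) =
      fun ξ => ∑ j, ∑ i,
        fderiv ℝ (g : Module.Dual ℝ V → ℝ) ξ ((Module.finBasis ℝ V).coord j) *
        (fderiv ℝ (f : Module.Dual ℝ V → ℝ) ξ ((Module.finBasis ℝ V).coord i) *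
          B.toFun ξ (Module.finBasis ℝ V i) (Module.finBasis ℝ V j)) := by
    funext ξ
    rw [differential_eq_sum f, differential_eq_sum g]
    simp [map_sum, LinearMap.sum_apply, Finset.mul_sum]
  rw [h]
  refine ContDiff.sum fun j _ => ContDiff.sum fun i _ => ?_
  exact (contDiff_fderiv_apply g contDiff_const).mul
    ((contDiff_fderiv_apply f contDiff_const).mul (B.contDiff_toFun _ _))

/-- The bidifferential operator `B(f, g)(ξ) = B_ξ(d_ξ f, d_ξ g)` on smooth functions that a
bivector field defines. -/
def BivectorField.bracket (B : BivectorField V) :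
    SmoothFun V →ₗ[ℝ] SmoothFun V →ₗ[ℝ] SmoothFun V :=
  LinearMap.mk₂ ℝ
    (fun f g => SmoothFun.mk (fun ξ => B.toFun ξ (differential f ξ) (differential g ξ))
      (B.contDiff_apply f g))
    (fun f₁ f₂ g => by
      ext ξ
      change B.toFun ξ (differential (f₁ + f₂) ξ) (differential g ξ) =
        B.toFun ξ (differential f₁ ξ) (differential g ξ) +
          B.toFun ξ (differential f₂ ξ) (differential g ξ)
      simp [differential_add])
    (fun c f g => by
      ext ξ
      change B.toFun ξ (differential (c • f) ξ) (differential g ξ) =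
        c * B.toFun ξ (differential f ξ) (differential g ξ)
      simp [differential_smul])
    (fun f g₁ g₂ => by
      ext ξ
      change B.toFun ξ (differential f ξ) (differential (g₁ + g₂) ξ) =
        B.toFun ξ (differential f ξ) (differential g₁ ξ) +
          B.toFun ξ (differential f ξ) (differential g₂ ξ)
      simp [differential_add])
    (fun c f g => by
      ext ξ
      change B.toFun ξ (differential f ξ) (differential (c • g) ξ) =
        c * B.toFun ξ (differential f ξ) (differential g ξ)
      simp [differential_smul])

/-- The action of a vector field `Z` on bilinear operators,
`(Z · B)(f, g) = Z(B(f, g)) - B(Z(f), g) - B(f, Z(g))`.  On (the operators of) bivector fields it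
is the Schouten–Nijenhuis bracket with `Z`. -/
def lieAct (Z : VectorField V) (B : SmoothFun V →ₗ[ℝ] SmoothFun V →ₗ[ℝ] SmoothFun V) :
    SmoothFun V →ₗ[ℝ] SmoothFun V →ₗ[ℝ] SmoothFun V :=
  B.compr₂ Z.act - B.comp Z.act - B.compl₂ Z.act

theorem lieAct_apply (Z : VectorField V) (B : SmoothFun V →ₗ[ℝ] SmoothFun V →ₗ[ℝ] SmoothFun V)
    (f g : SmoothFun V) :
    lieAct Z B f g = Z.act (B f g) - B (Z.act f) g - B f (Z.act g) := rfl

/-- The action of a formal vector field `Z = ∑ hⁿ Zₙ` on a formal series `B = ∑ hⁿ Bₙ` of bilinear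
operators: the coefficient of `hⁿ` in `Z · B` is `∑_{i + j = n} Zᵢ · Bⱼ`. -/
def formalLieAct (Z : ℕ → VectorField V)
    (B : ℕ → SmoothFun V →ₗ[ℝ] SmoothFun V →ₗ[ℝ] SmoothFun V) :
    ℕ → SmoothFun V →ₗ[ℝ] SmoothFun V →ₗ[ℝ] SmoothFun V :=
  fun n => ∑ p ∈ Finset.HasAntidiagonal.antidiagonal n, lieAct (Z p.1) (B p.2)

/-- The exponentiated action `exp(Z) · B = ∑ₖ (1 / k!) Zᵏ · B` of a formal vector field `Z` with
`Z₀ = 0`.  As `Z` is divisible by `h`, only the terms with `k ≤ n` contribute to the coefficient of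
`hⁿ`. -/
def expAct (Z : ℕ → VectorField V)
    (B : ℕ → SmoothFun V →ₗ[ℝ] SmoothFun V →ₗ[ℝ] SmoothFun V) :
    ℕ → SmoothFun V →ₗ[ℝ] SmoothFun V →ₗ[ℝ] SmoothFun V :=
  fun n => ∑ k ∈ Finset.range (n + 1),
    ((k.factorial : ℝ)⁻¹) • ((formalLieAct Z)^[k] B) n

/-- `β = ∑ h^(i+1) βᵢ` is a formal Poisson structure: the bracket that it defines on
`C^∞(V^*)[[h]]` satisfies the Jacobi identity, order by order in `h`. -/
def IsFormalPoisson (β : ℕ → BivectorField V) : Prop :=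
  ∀ (n : ℕ) (f g k : SmoothFun V),
    ∑ p ∈ Finset.HasAntidiagonal.antidiagonal n,
      ((β p.1).bracket f ((β p.2).bracket g k) + (β p.1).bracket g ((β p.2).bracket k f) +
        (β p.1).bracket k ((β p.2).bracket f g)) = 0

/-- `β = ∑ h^(i+1) βᵢ` is algebraic: the bracket of two polynomials is polynomial, at every order
in `h`. -/
def IsAlgebraic (β : ℕ → BivectorField V) : Prop :=
  ∀ (i : ℕ), ∀ p ∈ polynomialFun V, ∀ q ∈ polynomialFun V,
    (β i).bracket p q ∈ polynomialFun V

/-- Gauge equivalence of `β = ∑ h^(i+1) βᵢ` and `γ = ∑ h^(i+1) γᵢ`: there is a formal path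
`exp(Z)`, `Z = ∑_{n ≥ 1} hⁿ Zₙ`, in the diffeomorphism group of `V^*`, starting at the identity,
that carries `β` to `γ`. -/
def GaugeEquivalent (β γ : ℕ → BivectorField V) : Prop :=
  ∃ Z : ℕ → VectorField V, Z 0 = 0 ∧
    expAct Z (fun i => (β i).bracket) = fun i => (γ i).bracket

end PolyvectorFields

section Kirillov

variable (𝔤 : Type*) [LieRing 𝔤] [LieAlgebra ℝ 𝔤] [FiniteDimensional ℝ 𝔤]

/-- The Kirillov Poisson structure on `𝔤^*`, `{f, g}(ξ) = ξ([d_ξ f, d_ξ g])`. -/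
def kirillov : BivectorField 𝔤 where
  toFun ξ := LinearMap.mk₂ ℝ (fun X Y => ξ ⁅X, Y⁆)
    (fun _ _ _ => by simp) (fun _ _ _ => by simp) (fun _ _ _ => by simp) (fun _ _ _ => by simp)
  isAlt ξ X := by simp
  contDiff_toFun X Y := contDiff_eval ⁅X, Y⁆

end Kirillov

end KirillovDeformation

end

/-!
The deformation is removed order by order in `h`. Suppose that a gauge transformation `exp(Z)` has
already trivialized `β` below order `n`. Gauge transformations preserve the Jacobi identity
(`formalJacobiator_expAct`, the Leibniz rule for the divided powers `Zᵏ / k!`), so the coefficient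
`B` of `hⁿ` in `exp(Z) · β` is closed for the Poisson differential `[β₀, ·]`. On the other hand
`Zₙ` enters this coefficient only through the term `Zₙ · β₀` (`expAct_eq_add_lieAct`). It is
therefore enough to solve `B + Zₙ · β₀ = 0`, and the sequence of the `Zₙ` found in this way is the
required formal vector field: no composition of exponentials is needed.

As `B` is a biderivation, it is determined by its values on the linear functions `X ∈ 𝔤`. These
are polynomials of bounded degree, so they lie in a finite-dimensional submodule of `C^∞(𝔤^*)` on
which `𝔤` acts by Hamiltonian vector fields. Closedness says that `(X, Y) ↦ B(X, Y)` is a 2-cocycle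
of `𝔤` with values in this module, and the equation for `Zₙ` says that this cocycle is the
coboundary of `X ↦ Zₙ(X)`. So the theorem comes down to Whitehead's second lemma
(`LieModule.Cohomology.exists_d₁₂_eq_of_mem_twoCocycle`).

That lemma is proved by induction on the dimension of the module `M`. For trivial `M` a cocycle is
`κ(D x, y)` with `κ` the Killing form and `D` a derivation, and `D` is inner. Otherwise, by Cartan's
criterion, the trace form of `M` is nondegenerate on a nonzero ideal; its Casimir operator `Ω` has
nonzero trace, and `Ω ∘ c` is a coboundary for every cocycle `c`. So, up to coboundaries, `c` takes
its values in the generalized kernel of `Ω`, which is a proper submodule.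
-/

/-! ### Whitehead's second lemma -/

namespace LieModule.Cohomology

open LinearMap Module LieAlgebra

section Casimir

variable {K L M : Type*} [Field K] [LieRing L] [LieAlgebra K L]
  [AddCommGroup M] [Module K M] [LieRingModule L M] [LieModule K L M]

omit [LieAlgebra K L] in
/-- The canonical tensor `∑ bᵢ ⊗ bⁱ` of a nondegenerate invariant form is invariant; here it is
paired with an arbitrary bilinear map. -/
theorem sum_basis_dualBasis_lie_eq_zero {V N ι : Type*} [AddCommGroup V] [Module K V]
    [LieRingModule L V] [AddCommGroup N] [Module K N] [Fintype ι] [DecidableEq ι]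
    {Φ : LinearMap.BilinForm K V} (hΦ : Φ.Nondegenerate) (hinv : Φ.lieInvariant L)
    (b : Basis ι K V) (B : V →ₗ[K] V →ₗ[K] N) (x : L) :
    ∑ i, (B ⁅x, b i⁆ (Φ.dualBasis hΦ b i) + B (b i) ⁅x, Φ.dualBasis hΦ b i⁆) = 0 := by
  set f := Φ.dualBasis hΦ b with hf
  have h1 (v : V) : v = ∑ j, Φ (f j) v • b j := by
    have : ∀ j, Φ (f j) v = b.repr v j := fun j => by
      conv_lhs => rw [← b.sum_repr v]
      simp only [map_sum, map_smul, hf, LinearMap.BilinForm.apply_dualBasis_left, smul_eq_mul,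
        mul_ite, mul_one, mul_zero, Finset.sum_ite_eq', Finset.mem_univ, if_true]
    simp_rw [this, b.sum_repr]
  have h2 (v : V) : v = ∑ j, Φ v (b j) • f j := by
    conv_lhs => rw [← f.sum_repr v]
    simp_rw [hf, LinearMap.BilinForm.dualBasis_repr_apply]
  have h3 (i : ι) : B ⁅x, b i⁆ (f i) = -∑ j, Φ ⁅x, f j⁆ (b i) • B (b j) (f i) := by
    conv_lhs => rw [h1 ⁅x, b i⁆]
    have hinv' (i j : ι) : Φ (f j) ⁅x, b i⁆ = -Φ ⁅x, f j⁆ (b i) := by rw [hinv, neg_neg]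
    simp only [map_sum, map_smul, LinearMap.sum_apply, LinearMap.smul_apply, hinv', neg_smul,
      Finset.sum_neg_distrib, map_neg, LinearMap.neg_apply]
  have h4 (i : ι) : B (b i) ⁅x, f i⁆ = ∑ j, Φ ⁅x, f i⁆ (b j) • B (b i) (f j) := by
    conv_lhs => rw [h2 ⁅x, f i⁆]
    simp only [map_sum, map_smul]
  rw [Finset.sum_add_distrib]
  simp_rw [h3, h4]
  rw [Finset.sum_neg_distrib, Finset.sum_comm, neg_add_cancel]

variable {ι : Type*} [Fintype ι] {J : LieIdeal K L}

variable (M) in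
/-- The operator `∑ eⁱ eᵢ` on `M` given by two families `eᵢ`, `eⁱ` in an ideal.  It is a Casimir
operator when the families are dual bases for an invariant form. -/
def casimirEnd (e f : ι → J) : Module.End K M :=
  ∑ i, toEnd K L M (f i) ∘ₗ toEnd K L M (e i)

theorem casimirEnd_apply (e f : ι → J) (m : M) :
    casimirEnd (K := K) M e f m = ∑ i, ⁅(f i : L), ⁅(e i : L), m⁆⁆ := by
  simp [casimirEnd]

variable {e f : ι → J}

theorem casimirEnd_lie
    (hinv : ∀ (B : J →ₗ[K] J →ₗ[K] M) (x : L), ∑ i, (B ⁅x, e i⁆ (f i) + B (e i) ⁅x, f i⁆) = 0)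
    (x : L) (m : M) :
    casimirEnd (K := K) M e f ⁅x, m⁆ = ⁅x, casimirEnd (K := K) M e f m⁆ := by
  let B : J →ₗ[K] J →ₗ[K] M := LinearMap.mk₂ K (fun y z => ⁅(z : L), ⁅(y : L), m⁆⁆)
    (by simp) (by simp) (by simp) (by simp)
  have h := hinv B x
  simp only [casimirEnd_apply, lie_sum]
  rw [eq_comm, ← sub_eq_zero, ← Finset.sum_sub_distrib, ← h]
  refine Finset.sum_congr rfl fun i _ => ?_
  simp only [B, LinearMap.mk₂_apply, LieSubmodule.coe_bracket]
  rw [leibniz_lie x (f i : L), leibniz_lie x (e i : L)]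
  simp only [lie_add]
  abel

/-- The operator `c ↦ ∑ eⁱ c(eᵢ, ·)` is a homotopy between the Casimir operator and zero: on
cocycles the Casimir operator produces coboundaries. -/
theorem casimirEnd_comp_cocycle
    (hinv : ∀ (B : J →ₗ[K] J →ₗ[K] M) (x : L), ∑ i, (B ⁅x, e i⁆ (f i) + B (e i) ⁅x, f i⁆) = 0)
    {c : twoCochain K L M} (hc : c ∈ twoCocycle K L M) :
    ∃ φ : oneCochain K L M, ∀ x y, d₁₂ K L M φ x y = casimirEnd (K := K) M e f (c x y) := by
  refine ⟨∑ i, toEnd K L M (f i) ∘ₗ c.1 (e i), fun x y => ?_⟩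
  let B (y : L) : J →ₗ[K] J →ₗ[K] M := LinearMap.mk₂ K (fun a z => ⁅(z : L), c a y⁆)
    (fun _ _ _ => by simp [map_add]) (fun _ _ _ => by simp [map_smul]) (by simp) (by simp)
  have hx := hinv (B y) x
  have hy := hinv (B x) y
  rw [← sub_eq_zero, ← sub_eq_zero.2 (hx.trans hy.symm)]
  simp only [d₁₂_apply_apply, LinearMap.sum_apply, LinearMap.comp_apply, lie_sum,
    toEnd_apply_apply, casimirEnd_apply, ← Finset.sum_sub_distrib, twoCochain_val_apply]
  refine Finset.sum_congr rfl fun i _ => ?_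
  have hd : d₂₃ K L M c (e i) x y = 0 := by
    rw [mem_twoCocycle_iff] at hc
    simp [hc]
  rw [d₂₃_apply] at hd
  have hd' := congrArg (fun m => ⁅(f i : L), m⁆) hd
  simp only [lie_add, lie_sub, lie_zero] at hd'
  have e1 : c ⁅(e i : L), x⁆ y = - c ⁅x, (e i : L)⁆ y := by
    rw [← lie_skew, map_neg, LinearMap.neg_apply]
  have e2 : c ⁅(e i : L), y⁆ x = - c ⁅y, (e i : L)⁆ x := by
    rw [← lie_skew, map_neg, LinearMap.neg_apply]
  have e3 : c ⁅x, y⁆ (e i : L) = - c (e i : L) ⁅x, y⁆ := (twoCochain_skew c _ _).symm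
  rw [e1, e2, e3] at hd'
  simp only [lie_neg] at hd'
  simp only [B, LinearMap.mk₂_apply, LieSubmodule.coe_bracket]
  rw [leibniz_lie x (f i : L), leibniz_lie y (f i : L), ← sub_eq_zero,
    ← neg_eq_zero, ← hd']
  abel

end Casimir

section Cocycles

variable {K L M : Type*} [Field K] [LieRing L] [LieAlgebra K L]
  [AddCommGroup M] [Module K M] [LieRingModule L M] [LieModule K L M]

/-- Composition of a 2-cochain with a linear map of the coefficients. -/
def postcomp {N : Type*} [AddCommGroup N] [Module K N]
    (T : M →ₗ[K] N) (c : twoCochain K L M) : twoCochain K L N :=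
  ⟨c.1.compr₂ T, fun x => by simp⟩

omit [LieRingModule L M] [LieModule K L M] in
theorem postcomp_apply {N : Type*} [AddCommGroup N] [Module K N]
    (T : M →ₗ[K] N) (c : twoCochain K L M) (x y : L) : postcomp T c x y = T (c x y) := rfl

theorem postcomp_mem_twoCocycle {T : Module.End K M}
    (hT : ∀ (x : L) m, T ⁅x, m⁆ = ⁅x, T m⁆) {c : twoCochain K L M}
    (hc : c ∈ twoCocycle K L M) : postcomp T c ∈ twoCocycle K L M := by
  rw [mem_twoCocycle_iff] at hc ⊢
  ext x y z
  have h := congrArg T (LinearMap.congr_fun (LinearMap.congr_fun (LinearMap.congr_fun hc x) y) z)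
  simpa [hT, postcomp_apply, d₂₃_apply] using h

end Cocycles

section Semisimple

variable {K L : Type*} [Field K] [LieRing L] [LieAlgebra K L] [FiniteDimensional K L]

theorem lie_top_top_eq_top [IsKilling K L] :
    ⁅(⊤ : LieIdeal K L), (⊤ : LieIdeal K L)⁆ = ⊤ := by
  set I : LieIdeal K L := ⁅(⊤ : LieIdeal K L), (⊤ : LieIdeal K L)⁆ with hI
  have hcompl := I.isCompl_killingCompl
  have hab : IsLieAbelian I.killingCompl := by
    rw [LieSubmodule.lie_abelian_iff_lie_self_eq_bot, ← le_bot_iff, ← hcompl.inf_eq_bot]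
    refine le_inf ?_ (LieSubmodule.lie_le_left _ _)
    exact LieSubmodule.mono_lie le_top le_top
  have := IsKilling.ideal_eq_bot_of_isLieAbelian I.killingCompl
  rw [this] at hcompl
  simpa using hcompl.sup_eq_top

variable {M : Type*} [AddCommGroup M] [Module K M] [LieRingModule L M] [LieModule K L M]

/-- As `L = [L, L]`, the lower central series of `M` is constant from its first step on. -/
theorem isTrivial_of_isNilpotent [IsKilling K L] [LieModule.IsNilpotent L M] :
    IsTrivial L M := by
  have hstep (N : LieSubmodule K L M) :
      ⁅(⊤ : LieIdeal K L), N⁆ ≤ ⁅(⊤ : LieIdeal K L), ⁅(⊤ : LieIdeal K L), N⁆⁆ := by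
    conv_lhs => rw [← lie_top_top_eq_top]
    rw [LieSubmodule.lie_le_iff]
    intro x hx m hm
    rw [← LieSubmodule.mem_toSubmodule, LieSubmodule.lieIdeal_oper_eq_linear_span'] at hx
    induction hx using Submodule.span_induction with
    | mem x hx =>
      obtain ⟨y, -, z, -, rfl⟩ := hx
      rw [lie_lie]
      exact sub_mem (LieSubmodule.lie_mem_lie trivial (LieSubmodule.lie_mem_lie trivial hm))
        (LieSubmodule.lie_mem_lie trivial (LieSubmodule.lie_mem_lie trivial hm))
    | zero => simp
    | add x y _ _ hx hy => rw [add_lie]; exact add_mem hx hy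
    | smul t x _ hx => rw [smul_lie]; exact SMulMemClass.smul_mem t hx
  obtain ⟨k, hk⟩ := (LieModule.isNilpotent_iff K L M).1 inferInstance
  have hle (k : ℕ) : ⁅(⊤ : LieIdeal K L), (⊤ : LieSubmodule K L M)⁆ ≤
      lowerCentralSeries K L M k := by
    induction k with
    | zero => simp
    | succ k ih =>
      rw [lowerCentralSeries_succ]
      exact (hstep ⊤).trans (LieSubmodule.mono_lie le_rfl ih)
  refine ⟨fun x m => ?_⟩
  have h := hle k (LieSubmodule.lie_mem_lie (x := x) (m := m) trivial trivial)
  rwa [hk, LieSubmodule.mem_bot] at h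

/-- By Cartan's criterion `M` is nilpotent over `[L, L]`, which is all of `L`. -/
theorem isTrivial_of_traceForm_eq_zero [CharZero K] [IsKilling K L] [FiniteDimensional K M]
    (h : traceForm K L M = 0) : IsTrivial L M := by
  have hnil := LieModule.isNilpotent_derivedSeries_of_traceForm_eq_zero h
  have htop : derivedSeries K L 1 = ⊤ := by
    rw [derivedSeries_def, derivedSeriesOfIdeal_succ, derivedSeriesOfIdeal_zero,
      lie_top_top_eq_top]
  rw [LieModule.isNilpotent_iff_forall' (R := K)] at hnil
  have : LieModule.IsNilpotent L M := by
    rw [LieModule.isNilpotent_iff_forall' (R := K)]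
    exact fun x => hnil ⟨x, htop ▸ LieSubmodule.mem_top x⟩
  exact isTrivial_of_isNilpotent (K := K)

/-- For trivial coefficients a cocycle is `κ(D x, y)` with `D` a derivation, and derivations are
inner. -/
theorem exists_d₁₂_eq_of_isTrivial [IsKilling K L] [FiniteDimensional K M] [IsTrivial L M]
    {c : twoCochain K L M} (hc : c ∈ twoCocycle K L M) :
    ∃ φ : oneCochain K L M, d₁₂ K L M φ = c := by
  have hκ := IsKilling.killingForm_nondegenerate K L
  let b := finBasis K M
  have hcomp (k : Fin (finrank K M)) :
      ∃ z : L, ∀ x y, b.coord k (c x y) = killingForm K L z ⁅x, y⁆ := by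
    let D : L →ₗ[K] L := ((killingForm K L).toDual hκ).symm.toLinearMap ∘ₗ
      (c.1.compr₂ (b.coord k))
    have hD (x y : L) : killingForm K L (D x) y = b.coord k (c x y) :=
      LinearMap.BilinForm.apply_toDual_symm_apply (hB := hκ) (b.coord k ∘ₗ c.1 x) y
    have hcoc := (mem_twoCocycle_iff_of_trivial K L M c).1 hc
    let D' : LieDerivation K L L := ⟨D, fun x y => by
      refine ((killingForm K L).toDual hκ).injective (LinearMap.ext fun w => ?_)
      simp only [LinearMap.BilinForm.toDual_def, map_sub, LinearMap.sub_apply, hD]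
      have h1 : killingForm K L ⁅x, D y⁆ w = - killingForm K L (D y) ⁅x, w⁆ :=
        traceForm_lieInvariant K L L x (D y) w
      have h2 : killingForm K L ⁅y, D x⁆ w = - killingForm K L (D x) ⁅y, w⁆ :=
        traceForm_lieInvariant K L L y (D x) w
      rw [h1, h2, hD, hD, hcoc x y w, map_add]
      abel⟩
    obtain ⟨z, hz⟩ := LieDerivation.IsKilling.exists_eq_ad D'
    refine ⟨z, fun x y => ?_⟩
    have hzx : D x = ⁅z, x⁆ := by
      have : D' x = ⁅z, x⁆ := by rw [← hz, LieDerivation.ad_apply_apply]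
      exact this
    rw [← hD, hzx]
    exact traceForm_apply_lie_apply K L L z x y
  choose z hz using hcomp
  refine ⟨-∑ k, (killingForm K L (z k)).smulRight (b k), ?_⟩
  ext x y
  simp only [twoCochain_val_apply]
  rw [d₁₂_apply_apply_ofTrivial, ← b.sum_repr (c x y)]
  simp only [LinearMap.neg_apply, neg_neg, LinearMap.sum_apply, LinearMap.smulRight_apply, ← hz,
    Basis.coord_apply]

/-- The trace form of `M` is nondegenerate on an ideal complementary to its kernel, and this ideal
is nonzero unless the trace form vanishes. -/
theorem exists_nondegenerate_restrict_traceForm [IsKilling K L] :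
    ∃ J : LieIdeal K L, ((traceForm K L M).restrict J.toSubmodule).Nondegenerate ∧
      (J = ⊥ → traceForm K L M = 0) := by
  let I : LieIdeal K L :=
    { LinearMap.ker (traceForm K L M) with
      lie_mem := fun {x m} hm => by
        have hm' : traceForm K L M m = 0 := hm
        change traceForm K L M ⁅x, m⁆ = 0
        ext y
        have := traceForm_lieInvariant K L M x m y
        rw [this, hm']
        simp }
  have hI (x : L) : x ∈ I ↔ traceForm K L M x = 0 := Iff.rfl
  have hcompl := I.isCompl_killingCompl
  refine ⟨I.killingCompl, ?_, fun h => ?_⟩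
  · have hsymm : ((traceForm K L M).restrict I.killingCompl.toSubmodule).IsRefl := by
      intro x y h
      have h' : traceForm K L M x y = 0 := h
      change traceForm K L M y x = 0
      rw [traceForm_comm, h']
    refine hsymm.nondegenerate_iff_separatingLeft.2 ?_
    intro x hx
    have hxI : (x : L) ∈ I := by
      rw [hI]
      ext y
      have hy : y ∈ I ⊔ I.killingCompl := hcompl.sup_eq_top ▸ LieSubmodule.mem_top y
      obtain ⟨y₁, hy₁, y₂, hy₂, rfl⟩ := (LieSubmodule.mem_sup _ _ _).1 hy
      have h1 : traceForm K L M x y₁ = 0 := by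
        rw [traceForm_comm, (hI y₁).1 hy₁, LinearMap.zero_apply]
      have h2 : traceForm K L M x y₂ = 0 := hx ⟨y₂, hy₂⟩
      simp [h1, h2]
    have : (x : L) ∈ I ⊓ I.killingCompl := ⟨hxI, x.2⟩
    rw [hcompl.inf_eq_bot, LieSubmodule.mem_bot] at this
    exact Subtype.ext this
  · rw [h] at hcompl
    have hI' : I = ⊤ := by simpa using hcompl.sup_eq_top
    exact LinearMap.ext fun x => (hI x).1 (hI' ▸ LieSubmodule.mem_top x)

omit [FiniteDimensional K L] in
theorem trace_casimirEnd [FiniteDimensional K M] {J : LieIdeal K L} {ι : Type*} [Fintype ι]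
    [DecidableEq ι] (hJ : ((traceForm K L M).restrict J.toSubmodule).Nondegenerate)
    (b : Basis ι K J) :
    LinearMap.trace K M (casimirEnd M b
      (((traceForm K L M).restrict J.toSubmodule).dualBasis hJ b)) = Fintype.card ι := by
  have h (i : ι) : LinearMap.trace K M (toEnd K L M
      (((traceForm K L M).restrict J.toSubmodule).dualBasis hJ b i) ∘ₗ toEnd K L M (b i)) = 1 := by
    have := LinearMap.BilinForm.apply_dualBasis_left hJ b i i
    rw [if_pos rfl] at this
    exact this
  simp only [casimirEnd, map_sum]
  rw [Finset.sum_congr rfl fun i _ => h i]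
  simp

variable (K L) in
/-- **Whitehead's second lemma**: `H²(L, M) = 0` for a finite-dimensional module `M` over a
semisimple Lie algebra `L` in characteristic zero. -/
theorem exists_d₁₂_eq_of_mem_twoCocycle [CharZero K] [IsKilling K L] (n : ℕ) :
    ∀ (M : Type*) [AddCommGroup M] [Module K M] [LieRingModule L M] [LieModule K L M]
      [FiniteDimensional K M], finrank K M = n → ∀ c ∈ twoCocycle K L M,
      ∃ φ : oneCochain K L M, d₁₂ K L M φ = c := by
  induction n using Nat.strong_induction_on with
  | _ n ih =>
  intro M _ _ _ _ _ hn c hc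
  classical
  obtain ⟨J, hJ, hJbot⟩ := exists_nondegenerate_restrict_traceForm (K := K) (L := L) (M := M)
  by_cases hJ0 : J = ⊥
  · have := isTrivial_of_traceForm_eq_zero (hJbot hJ0)
    exact exists_d₁₂_eq_of_isTrivial hc
  let b := finBasis K J
  let Φ : LinearMap.BilinForm K J := (traceForm K L M).restrict J.toSubmodule
  replace hJ : Φ.Nondegenerate := hJ
  have hΦinv : Φ.lieInvariant L := fun x y z => traceForm_lieInvariant K L M x y z
  have hinv (B : J →ₗ[K] J →ₗ[K] M) (x : L) :=
    sum_basis_dualBasis_lie_eq_zero hJ hΦinv b B x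
  let Ω : Module.End K M := casimirEnd M b (Φ.dualBasis hJ b)
  have hΩlie : ∀ (x : L) m, Ω ⁅x, m⁆ = ⁅x, Ω m⁆ := casimirEnd_lie hinv
  have hΩtr : LinearMap.trace K M Ω ≠ 0 := by
    rw [trace_casimirEnd hJ b, Fintype.card_fin, Nat.cast_ne_zero, Ne, finrank_eq_zero_iff_of_free]
    intro hs
    exact hJ0 ((LieSubmodule.eq_bot_iff J).2 fun x hx =>
      congrArg Subtype.val (Subsingleton.elim (⟨x, hx⟩ : J) 0))
  have hpoly (p : Polynomial K) (x : L) (m : M) :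
      Polynomial.aeval Ω p ⁅x, m⁆ = ⁅x, Polynomial.aeval Ω p m⁆ := by
    induction p using Polynomial.induction_on' with
    | add p q hp hq => simp [hp, hq]
    | monomial k a =>
      have hpow : (Ω ^ k) ⁅x, m⁆ = ⁅x, (Ω ^ k) m⁆ := by
        induction k with
        | zero => simp
        | succ k ih => rw [pow_succ', Module.End.mul_apply, ih, hΩlie, Module.End.mul_apply]
      simp [Polynomial.aeval_monomial, hpow]
  -- Split the minimal polynomial of `Ω` as `X ^ k * q` with `q(0) ≠ 0`.
  obtain ⟨q, hq, hXq⟩ := Polynomial.exists_eq_pow_rootMultiplicity_mul_and_not_dvd (minpoly K Ω)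
    (minpoly.ne_zero (Algebra.IsIntegral.isIntegral Ω)) 0
  rw [map_zero, sub_zero] at hq hXq
  set k := (minpoly K Ω).rootMultiplicity 0
  have hq0 : q.coeff 0 ≠ 0 := by rwa [Polynomial.X_dvd_iff] at hXq
  have hkill (m : M) : (Ω ^ k) (Polynomial.aeval Ω q m) = 0 := by
    have := congrArg (fun p => Polynomial.aeval Ω p m) hq
    simpa using this.symm
  let N : LieSubmodule K L M :=
    { LinearMap.ker (Ω ^ k) with
      lie_mem := fun {x m} hm => by
        have hm' : (Ω ^ k) m = 0 := hm
        change (Ω ^ k) ⁅x, m⁆ = 0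
        have := hpoly (Polynomial.X ^ k) x m
        simp only [map_pow, Polynomial.aeval_X] at this
        rw [this, hm', lie_zero] }
  -- If `N` were all of `M`, the operator `Ω` would be nilpotent and its trace zero.
  have hN : finrank K N < n := by
    rw [← hn]
    refine Submodule.finrank_lt (s := N.toSubmodule) fun htop => hΩtr ?_
    refine (LinearMap.isNilpotent_trace_of_isNilpotent ⟨k, ?_⟩).eq_zero
    exact LinearMap.ext fun m => (htop ▸ Submodule.mem_top : m ∈ N.toSubmodule)
  -- `q(Ω) ∘ c` takes its values in `N`, and is a coboundary by induction.
  let cN : twoCochain K L N := ⟨LinearMap.mk₂ K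
    (fun x y => (⟨Polynomial.aeval Ω q (c x y), hkill _⟩ : N))
    (fun _ _ _ => Subtype.ext (by simp [map_add])) (fun _ _ _ => Subtype.ext (by simp [map_smul]))
    (fun _ _ _ => Subtype.ext (by simp)) (fun _ _ _ => Subtype.ext (by simp)),
    fun x => Subtype.ext (by simp)⟩
  have hcN : cN ∈ twoCocycle K L N := by
    have h := postcomp_mem_twoCocycle (hpoly q) hc
    rw [mem_twoCocycle_iff] at h ⊢
    ext x y z
    exact LinearMap.congr_fun (LinearMap.congr_fun (LinearMap.congr_fun h x) y) z
  obtain ⟨φ₁, hφ₁⟩ := ih _ hN N rfl cN hcN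
  -- The rest of `q(0) • c` is a polynomial multiple of `Ω ∘ c`.
  obtain ⟨φ₂, hφ₂⟩ := casimirEnd_comp_cocycle hinv
    (postcomp_mem_twoCocycle (hpoly q.divX) hc)
  refine ⟨(q.coeff 0)⁻¹ • (N.toSubmodule.subtype ∘ₗ φ₁ - φ₂), ?_⟩
  have hval (x y : L) : d₁₂ K L M (N.toSubmodule.subtype ∘ₗ φ₁) x y =
      Polynomial.aeval Ω q (c x y) := by
    have := congrArg (fun a : twoCochain K L N => ((a x y : N) : M)) hφ₁
    exact this
  have hsplit (m : M) : Polynomial.aeval Ω q m =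
      Ω (Polynomial.aeval Ω q.divX m) + q.coeff 0 • m := by
    conv_lhs => rw [← Polynomial.X_mul_divX_add q]
    simp only [map_add, map_mul, Polynomial.aeval_X, Polynomial.aeval_C, LinearMap.add_apply,
      Module.End.mul_apply, Module.algebraMap_end_apply]
  ext x y
  rw [map_smul, map_sub]
  change (q.coeff 0)⁻¹ • (d₁₂ K L M (N.toSubmodule.subtype ∘ₗ φ₁) x y - d₁₂ K L M φ₂ x y) = c x y
  rw [hval, hφ₂, hsplit, postcomp_apply]
  change (q.coeff 0)⁻¹ • (Ω _ + q.coeff 0 • c x y - Ω _) = c x y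
  rw [add_sub_cancel_left, smul_smul, inv_mul_cancel₀ hq0, one_smul]

end Semisimple

end LieModule.Cohomology

namespace KirillovDeformation

noncomputable section

open Finset (range mem_range mem_filter mem_product)
open Finset.HasAntidiagonal (antidiagonal mem_antidiagonal)

/-! ### Gauge transformations of formal Poisson brackets -/

section Antidiagonal

theorem sum_antidiagonal_assoc {M : Type*} [AddCommMonoid M] (F : ℕ → ℕ → ℕ → M) (n : ℕ) :
    ∑ p ∈ antidiagonal n, ∑ q ∈ antidiagonal p.1, F q.1 q.2 p.2 =
      ∑ p ∈ antidiagonal n, ∑ q ∈ antidiagonal p.2, F p.1 q.1 q.2 := by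
  simp only [Finset.sum_sigma']
  apply Finset.sum_nbij' (fun ⟨⟨_i, j⟩, ⟨k, l⟩⟩ ↦ ⟨(k, l + j), (l, j)⟩)
    (fun ⟨⟨i, _j⟩, ⟨k, l⟩⟩ ↦ ⟨(i + k, l), (i, k)⟩)
  all_goals
    simp only [Finset.mem_sigma, mem_antidiagonal, and_imp, Sigma.forall, Prod.forall]
  · intro a b c d h1 h2
    exact ⟨by omega, trivial⟩
  · intro a b c d h1 h2
    exact ⟨by omega, trivial⟩
  · rintro a b c d - rfl
    rfl
  · rintro a b c d - rfl
    rfl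
  · rintro a b c d - -
    trivial

theorem sum_antidiagonal_left_comm {M : Type*} [AddCommMonoid M] (F : ℕ → ℕ → ℕ → M) (n : ℕ) :
    ∑ p ∈ antidiagonal n, ∑ q ∈ antidiagonal p.2, F p.1 q.1 q.2 =
      ∑ p ∈ antidiagonal n, ∑ q ∈ antidiagonal p.2, F q.1 p.1 q.2 := by
  rw [← sum_antidiagonal_assoc, ← sum_antidiagonal_assoc fun a b c => F b a c]
  exact Finset.sum_congr rfl fun p _ =>
    (Finset.Nat.sum_antidiagonal_swap (n := p.1) (f := fun q => F q.1 q.2 p.2)).symm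

/-- A sum over a square of terms that vanish beyond the diagonal, taken along antidiagonals. -/
theorem sum_range_product_eq_sum_antidiagonal {M : Type*} [AddCommMonoid M] (n : ℕ)
    (F : ℕ → ℕ → M) (hF : ∀ k l, n < k + l → F k l = 0) :
    ∑ k ∈ range (n + 1), ∑ l ∈ range (n + 1), F k l =
      ∑ m ∈ range (n + 1), ∑ p ∈ antidiagonal m, F p.1 p.2 := by
  rw [← Finset.sum_product' (range (n + 1)) (range (n + 1)) F,
    ← Finset.sum_filter_of_ne (p := fun x : ℕ × ℕ => x.1 + x.2 < n + 1),
    ← Finset.sum_fiberwise_of_maps_to (g := fun x : ℕ × ℕ => x.1 + x.2) (t := range (n + 1))]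
  · refine Finset.sum_congr rfl fun m hm => Finset.sum_congr ?_ fun _ _ => rfl
    ext ⟨k, l⟩
    simp only [mem_filter, mem_product, mem_range, mem_antidiagonal] at hm ⊢
    omega
  · intro x hx
    simpa using (mem_filter.1 hx).2
  · intro x _ hx
    by_contra h
    exact hx (hF _ _ (by omega))

end Antidiagonal

variable {V : Type*} [AddCommGroup V] [Module ℝ V] [FiniteDimensional ℝ V]

variable (V) in
/-- Bilinear operators on `C^∞(V^*)`. -/
abbrev BilinOp : Type _ := SmoothFun V →ₗ[ℝ] SmoothFun V →ₗ[ℝ] SmoothFun V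

variable (V) in
/-- Ternary operators on `C^∞(V^*)`. -/
abbrev TriOp : Type _ := SmoothFun V → SmoothFun V → SmoothFun V → SmoothFun V

theorem VectorField.act_zero : (0 : VectorField V).act = 0 := by
  ext f ξ
  exact map_zero (fderiv ℝ (f : Module.Dual ℝ V → ℝ) ξ)

theorem lieAct_zero_left (B : BilinOp V) : lieAct 0 B = 0 := by
  ext f g : 2
  simp [lieAct_apply, VectorField.act_zero]

theorem lieAct_add (Z : VectorField V) (B C : BilinOp V) :
    lieAct Z (B + C) = lieAct Z B + lieAct Z C := by
  ext f g : 2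
  simp only [lieAct_apply, LinearMap.add_apply, map_add]
  abel

theorem lieAct_smul (Z : VectorField V) (r : ℝ) (B : BilinOp V) :
    lieAct Z (r • B) = r • lieAct Z B := by
  ext f g : 2
  simp only [lieAct_apply, LinearMap.smul_apply, map_smul, smul_sub]

theorem lieAct_zero (Z : VectorField V) : lieAct Z (0 : BilinOp V) = 0 := by
  simpa using lieAct_smul Z 0 0

theorem formalLieAct_smul (Z : ℕ → VectorField V) (r : ℝ) (B : ℕ → BilinOp V) :
    formalLieAct Z (r • B) = r • formalLieAct Z B := by
  funext n
  simp only [formalLieAct, Pi.smul_apply, lieAct_smul, Finset.smul_sum]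

/-- The action `(Z · T)(f, g, k) = Z(T(f, g, k)) - T(Zf, g, k) - T(f, Zg, k) - T(f, g, Zk)` of a
vector field on ternary operators. -/
def triAct (Z : VectorField V) : TriOp V →+ TriOp V where
  toFun T f g k := Z.act (T f g k) - T (Z.act f) g k - T f (Z.act g) k - T f g (Z.act k)
  map_zero' := by
    funext f g k
    simp
  map_add' S T := by
    funext f g k
    simp only [Pi.add_apply, map_add]
    abel

/-- The cyclic sum `B(f, C(g, k)) + B(g, C(k, f)) + B(k, C(f, g))`. For `B = C` its vanishing is the
Jacobi identity. -/
def jacobiator : BilinOp V →ₗ[ℝ] BilinOp V →ₗ[ℝ] TriOp V :=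
  LinearMap.mk₂ ℝ (fun B C f g k => B f (C g k) + B g (C k f) + B k (C f g))
    (fun B B' C => by funext f g k; simp only [LinearMap.add_apply, Pi.add_apply]; abel)
    (fun r B C => by funext f g k; simp only [LinearMap.smul_apply, Pi.smul_apply, smul_add])
    (fun B C C' => by
      funext f g k; simp only [LinearMap.add_apply, Pi.add_apply, map_add]; abel)
    (fun r B C => by
      funext f g k; simp only [LinearMap.smul_apply, Pi.smul_apply, smul_add, map_smul])

theorem jacobiator_apply (B C : BilinOp V) (f g k : SmoothFun V) :
    jacobiator B C f g k = B f (C g k) + B g (C k f) + B k (C f g) := rfl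

theorem triAct_jacobiator (Z : VectorField V) (B C : BilinOp V) :
    triAct Z (jacobiator B C) = jacobiator (lieAct Z B) C + jacobiator B (lieAct Z C) := by
  funext f g k
  change Z.act (jacobiator B C f g k) - jacobiator B C (Z.act f) g k -
    jacobiator B C f (Z.act g) k - jacobiator B C f g (Z.act k) =
    jacobiator (lieAct Z B) C f g k + jacobiator B (lieAct Z C) f g k
  simp only [jacobiator_apply, lieAct_apply, map_add, map_sub]
  abel

/-- The `h`-bilinear extension of `jacobiator` to formal series. -/
def formalJacobiator (B C : ℕ → BilinOp V) (n : ℕ) : TriOp V :=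
  ∑ p ∈ antidiagonal n, jacobiator (B p.1) (C p.2)

theorem isFormalPoisson_iff (β : ℕ → BivectorField V) :
    IsFormalPoisson β ↔
      formalJacobiator (fun i => (β i).bracket) (fun i => (β i).bracket) = 0 := by
  simp only [IsFormalPoisson, funext_iff, formalJacobiator, Finset.sum_apply, jacobiator_apply,
    Pi.zero_apply]

theorem sum_triAct_formalJacobiator (Z : ℕ → VectorField V) (B C : ℕ → BilinOp V) (n : ℕ) :
    ∑ p ∈ antidiagonal n, triAct (Z p.1) (formalJacobiator B C p.2) =
      formalJacobiator (formalLieAct Z B) C n + formalJacobiator B (formalLieAct Z C) n := by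
  simp only [formalJacobiator, formalLieAct, map_sum, LinearMap.sum_apply, triAct_jacobiator,
    Finset.sum_add_distrib]
  rw [sum_antidiagonal_assoc fun a b c => jacobiator (lieAct (Z a) (B b)) (C c),
    sum_antidiagonal_left_comm fun a b c => jacobiator (B a) (lieAct (Z b) (C c))]

/-- The divided powers `Zᵏ · B / k!` of the action of a formal vector field. -/
def expTerm (Z : ℕ → VectorField V) (B : ℕ → BilinOp V) (k : ℕ) : ℕ → BilinOp V :=
  ((k.factorial : ℝ)⁻¹) • (formalLieAct Z)^[k] B

theorem formalLieAct_expTerm (Z : ℕ → VectorField V) (B : ℕ → BilinOp V) (k : ℕ) :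
    formalLieAct Z (expTerm Z B k) = ((k + 1 : ℕ) : ℝ) • expTerm Z B (k + 1) := by
  rw [expTerm, expTerm, formalLieAct_smul, smul_smul,
    Function.iterate_succ_apply']
  congr 1
  rw [Nat.factorial_succ]
  push_cast
  field_simp

theorem formalLieAct_iterate_eq_zero {Z : ℕ → VectorField V} (hZ : Z 0 = 0)
    (B : ℕ → BilinOp V) (k : ℕ) : ∀ n < k, (formalLieAct Z)^[k] B n = 0 := by
  induction k with
  | zero => exact fun n hn => absurd hn (Nat.not_lt_zero n)
  | succ k ih =>
    intro n hn
    rw [Function.iterate_succ_apply', formalLieAct]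
    refine Finset.sum_eq_zero fun p hp => ?_
    rw [mem_antidiagonal] at hp
    rcases Nat.eq_zero_or_pos p.1 with h | h
    · rw [h, hZ, lieAct_zero_left]
    · rw [ih p.2 (by omega), lieAct_zero]

theorem expTerm_eq_zero {Z : ℕ → VectorField V} (hZ : Z 0 = 0) (B : ℕ → BilinOp V) {k n : ℕ}
    (h : n < k) : expTerm Z B k n = 0 := by
  rw [expTerm, Pi.smul_apply, formalLieAct_iterate_eq_zero hZ B k n h, smul_zero]

theorem expAct_eq_sum_expTerm {Z : ℕ → VectorField V} (hZ : Z 0 = 0) (B : ℕ → BilinOp V)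
    {n N : ℕ} (h : n ≤ N) : expAct Z B n = ∑ k ∈ range (N + 1), expTerm Z B k n := by
  rw [← Finset.sum_subset (Finset.range_mono (Nat.succ_le_succ h))]
  · rfl
  · intro k _ hk
    exact expTerm_eq_zero hZ B (by simpa using hk)

theorem formalJacobiator_smul_left (r : ℝ) (B C : ℕ → BilinOp V) :
    formalJacobiator (r • B) C = r • formalJacobiator B C := by
  refine funext fun n => ?_
  simp only [formalJacobiator, Pi.smul_apply (i := n), Finset.smul_sum]
  exact Finset.sum_congr rfl fun p _ => by
    rw [Pi.smul_apply, map_smul, LinearMap.smul_apply]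

theorem formalJacobiator_smul_right (r : ℝ) (B C : ℕ → BilinOp V) :
    formalJacobiator B (r • C) = r • formalJacobiator B C := by
  refine funext fun n => ?_
  simp only [formalJacobiator, Pi.smul_apply (i := n), Finset.smul_sum]
  exact Finset.sum_congr rfl fun p _ => by
    rw [Pi.smul_apply, map_smul]

/-- The Leibniz rule for divided powers: the part of degree `m` in `Z` of the Jacobiator of
`exp(Z) · B` is `Zᵐ / m!` applied to the Jacobiator of `B`. -/
theorem sum_formalJacobiator_expTerm (Z : ℕ → VectorField V) {B : ℕ → BilinOp V}
    (hB : formalJacobiator B B = 0) (m : ℕ) :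
    ∑ p ∈ antidiagonal m, formalJacobiator (expTerm Z B p.1) (expTerm Z B p.2) = 0 := by
  induction m with
  | zero => simpa [expTerm] using hB
  | succ m ih =>
    have h : ((m + 1 : ℕ) : ℝ) • ∑ p ∈ antidiagonal (m + 1),
        formalJacobiator (expTerm Z B p.1) (expTerm Z B p.2) = 0 := by
      calc _ = ∑ p ∈ antidiagonal (m + 1), ((p.1 : ℝ) + (p.2 : ℝ)) •
            formalJacobiator (expTerm Z B p.1) (expTerm Z B p.2) := by
            rw [Finset.smul_sum]
            refine Finset.sum_congr rfl fun p hp => ?_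
            rw [← mem_antidiagonal.1 hp, Nat.cast_add]
        _ = ∑ p ∈ antidiagonal m,
            (formalJacobiator (formalLieAct Z (expTerm Z B p.1)) (expTerm Z B p.2) +
              formalJacobiator (expTerm Z B p.1) (formalLieAct Z (expTerm Z B p.2))) := by
            simp only [add_smul, Finset.sum_add_distrib]
            congr 1
            · rw [Finset.Nat.sum_antidiagonal_succ]
              simp [formalLieAct_expTerm, formalJacobiator_smul_left]
            · rw [Finset.Nat.sum_antidiagonal_succ']
              simp [formalLieAct_expTerm, formalJacobiator_smul_right]
        _ = 0 := by
            refine funext fun n => ?_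
            simp only [Finset.sum_apply, Pi.add_apply, ← sum_triAct_formalJacobiator]
            rw [Finset.sum_comm]
            refine Finset.sum_eq_zero fun p _ => ?_
            rw [← map_sum, ← Finset.sum_apply, ih, Pi.zero_apply, map_zero]
    have hm : ((m + 1 : ℕ) : ℝ) ≠ 0 := Nat.cast_ne_zero.2 m.succ_ne_zero
    rw [← inv_smul_smul₀ hm (∑ p ∈ antidiagonal (m + 1), _), h, smul_zero]

/-- Gauge transformations preserve the Jacobi identity. -/
theorem formalJacobiator_expAct {Z : ℕ → VectorField V} (hZ : Z 0 = 0) {B : ℕ → BilinOp V}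
    (hB : formalJacobiator B B = 0) : formalJacobiator (expAct Z B) (expAct Z B) = 0 := by
  refine funext fun n => ?_
  have h : formalJacobiator (expAct Z B) (expAct Z B) n =
      ∑ k ∈ range (n + 1), ∑ l ∈ range (n + 1),
        formalJacobiator (expTerm Z B k) (expTerm Z B l) n := by
    simp only [formalJacobiator]
    simp_rw [Finset.sum_comm (s := range (n + 1)) (t := antidiagonal n)]
    refine Finset.sum_congr rfl fun p hp => ?_
    rw [mem_antidiagonal] at hp
    rw [expAct_eq_sum_expTerm hZ B (show p.1 ≤ n by omega),
      expAct_eq_sum_expTerm hZ B (show p.2 ≤ n by omega)]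
    simp only [map_sum, LinearMap.sum_apply]
    rw [Finset.sum_comm]
  rw [h, sum_range_product_eq_sum_antidiagonal]
  · refine Finset.sum_eq_zero fun m _ => ?_
    rw [← Finset.sum_apply, sum_formalJacobiator_expTerm Z hB, Pi.zero_apply]
  · intro k l hkl
    refine Finset.sum_eq_zero fun p hp => ?_
    rw [mem_antidiagonal] at hp
    rcases Nat.lt_or_ge p.1 k with h | h
    · rw [expTerm_eq_zero hZ B h, map_zero, LinearMap.zero_apply]
    · rw [expTerm_eq_zero hZ B (show p.2 < l by omega), map_zero]

theorem formalLieAct_iterate_congr {Z Z' : ℕ → VectorField V} (hZ : Z 0 = 0) (hZ' : Z' 0 = 0)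
    {n : ℕ} (h : ∀ i < n, Z i = Z' i) (B : ℕ → BilinOp V) (k : ℕ) :
    (∀ j < n, (formalLieAct Z)^[k] B j = (formalLieAct Z')^[k] B j) ∧
      (k ≠ 1 → (formalLieAct Z)^[k] B n = (formalLieAct Z')^[k] B n) := by
  induction k with
  | zero => simp only [Function.iterate_zero, id, implies_true, and_self]
  | succ k ih =>
    simp only [Function.iterate_succ_apply', formalLieAct]
    refine ⟨fun j hj => Finset.sum_congr rfl fun p hp => ?_, fun hk =>
      Finset.sum_congr rfl fun p hp => ?_⟩
    · rw [mem_antidiagonal] at hp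
      rw [h p.1 (by omega), ih.1 p.2 (by omega)]
    · rw [mem_antidiagonal] at hp
      rcases Nat.eq_zero_or_pos p.1 with h0 | h0
      · rw [h0, hZ, hZ', lieAct_zero_left, lieAct_zero_left]
      rcases Nat.eq_zero_or_pos p.2 with h1 | h1
      · rw [h1, formalLieAct_iterate_eq_zero hZ B k 0 (by omega),
          formalLieAct_iterate_eq_zero hZ' B k 0 (by omega), lieAct_zero, lieAct_zero]
      · rw [h p.1 (by omega), ih.1 p.2 (by omega)]

theorem expAct_congr {Z Z' : ℕ → VectorField V} (hZ : Z 0 = 0) (hZ' : Z' 0 = 0)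
    {n : ℕ} (h : ∀ i ≤ n, Z i = Z' i) (B : ℕ → BilinOp V) : expAct Z B n = expAct Z' B n :=
  Finset.sum_congr rfl fun k _ => by
    rw [(formalLieAct_iterate_congr hZ hZ' (n := n + 1) (fun i hi => h i (by omega)) B k).1 n
      (by omega)]

theorem expAct_zero {Z : ℕ → VectorField V} (B : ℕ → BilinOp V) : expAct Z B 0 = B 0 := by
  simp [expAct]

/-- The coefficient `Zₙ` enters the coefficient of `hⁿ` in `exp(Z) · B` only through
`Zₙ · B₀`. -/
theorem expAct_eq_add_lieAct {Z Z' : ℕ → VectorField V} (hZ : Z 0 = 0) (hZ' : Z' 0 = 0)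
    {n : ℕ} (hn : n ≠ 0) (h : ∀ i < n, Z i = Z' i) (hZn : Z n = 0) (B : ℕ → BilinOp V) :
    expAct Z' B n = expAct Z B n + lieAct (Z' n) (B 0) := by
  have h1 : formalLieAct Z' B n = formalLieAct Z B n + lieAct (Z' n) (B 0) := by
    obtain ⟨m, rfl⟩ := Nat.exists_eq_succ_of_ne_zero hn
    simp only [formalLieAct, Nat.succ_eq_add_one, Finset.Nat.sum_antidiagonal_succ', hZn,
      lieAct_zero_left, zero_add]
    rw [add_comm]
    congr 1
    refine Finset.sum_congr rfl fun p hp => ?_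
    rw [mem_antidiagonal] at hp
    rw [h p.1 (by omega)]
  have hmem : 1 ∈ range (n + 1) := by simp; omega
  rw [expAct, expAct, ← Finset.add_sum_erase _ _ hmem, ← Finset.add_sum_erase _ _ hmem]
  simp only [Function.iterate_one, h1, Nat.factorial_one, Nat.cast_one, inv_one, one_smul]
  rw [add_right_comm]
  congr 1
  congr 1
  refine Finset.sum_congr rfl fun k hk => ?_
  rw [(formalLieAct_iterate_congr hZ hZ' h B k).2 (Finset.ne_of_mem_erase hk)]

/-! ### Vector fields and bivector fields as differential operators -/

section Operators

variable {V : Type*} [AddCommGroup V] [Module ℝ V] [FiniteDimensional ℝ V]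

theorem VectorField.act_apply (Z : VectorField V) (f : SmoothFun V) (ξ : Module.Dual ℝ V) :
    Z.act f ξ = fderiv ℝ (f : Module.Dual ℝ V → ℝ) ξ (Z.toFun ξ) := rfl

theorem BivectorField.bracket_apply (B : BivectorField V) (f g : SmoothFun V)
    (ξ : Module.Dual ℝ V) :
    B.bracket f g ξ = B.toFun ξ (differential f ξ) (differential g ξ) := rfl

theorem sum_mul_apply {ι : Type*} (s : Finset ι) (f g : ι → SmoothFun V)
    (ξ : Module.Dual ℝ V) : (∑ i ∈ s, f i * g i) ξ = ∑ i ∈ s, f i ξ * g i ξ :=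
  map_sum (ContMDiffMap.evalRingHom (n := ∞) ξ) (fun i => f i * g i) s

variable (V) in
/-- The linear functions on `V^*`, as a linear map `V → C^∞(V^*)`. -/
def linearFunₗ : V →ₗ[ℝ] SmoothFun V where
  toFun := linearFun
  map_add' X Y := by
    ext ξ
    exact map_add ξ X Y
  map_smul' r X := by
    ext ξ
    exact map_smul ξ r X

theorem linearFunₗ_apply (X : V) : linearFunₗ V X = linearFun X := rfl

theorem fderiv_linearFun (X : V) (ξ η : Module.Dual ℝ V) :
    fderiv ℝ (linearFun X : Module.Dual ℝ V → ℝ) ξ η = η X :=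
  congrArg (fun T : Module.Dual ℝ V →L[ℝ] ℝ => T η)
    (LinearMap.toContinuousLinearMap (Module.Dual.eval ℝ V X)).fderiv

theorem differential_linearFun (X : V) (ξ : Module.Dual ℝ V) :
    differential (linearFun X) ξ = X := by
  rw [← sub_eq_zero, ← Module.forall_dual_apply_eq_zero_iff ℝ]
  intro η
  rw [map_sub, apply_differential, fderiv_linearFun, sub_self]

theorem VectorField.act_linearFun_apply (Z : VectorField V) (X : V) (ξ : Module.Dual ℝ V) :
    Z.act (linearFun X) ξ = Z.toFun ξ X :=
  fderiv_linearFun X ξ _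

theorem VectorField.act_mul (Z : VectorField V) (f g : SmoothFun V) :
    Z.act (f * g) = f * Z.act g + g * Z.act f := by
  ext ξ
  have h : fderiv ℝ ((f : Module.Dual ℝ V → ℝ) * (g : Module.Dual ℝ V → ℝ)) ξ =
      f ξ • fderiv ℝ (g : Module.Dual ℝ V → ℝ) ξ + g ξ • fderiv ℝ (f : Module.Dual ℝ V → ℝ) ξ :=
    fderiv_mul (f.differentiable ξ) (g.differentiable ξ)
  exact congrArg (fun T : Module.Dual ℝ V →L[ℝ] ℝ => T (Z.toFun ξ)) h

/-- The partial derivatives of functions on `V^*` in the coordinates given by a basis of `V`. -/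
def partialDeriv (i : Fin (Module.finrank ℝ V)) : SmoothFun V →ₗ[ℝ] SmoothFun V :=
  VectorField.act ⟨fun _ => (Module.finBasis ℝ V).coord i, contDiff_const⟩

theorem partialDeriv_mul (i : Fin (Module.finrank ℝ V)) (f g : SmoothFun V) :
    partialDeriv i (f * g) = f * partialDeriv i g + g * partialDeriv i f :=
  VectorField.act_mul _ f g

theorem partialDeriv_apply (i : Fin (Module.finrank ℝ V)) (f : SmoothFun V)
    (ξ : Module.Dual ℝ V) : partialDeriv i f ξ =
      fderiv ℝ (f : Module.Dual ℝ V → ℝ) ξ ((Module.finBasis ℝ V).coord i) := rfl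

theorem partialDeriv_comm (i j : Fin (Module.finrank ℝ V)) (f : SmoothFun V) :
    partialDeriv i (partialDeriv j f) = partialDeriv j (partialDeriv i f) := by
  ext ξ
  have hd : DifferentiableAt ℝ (fderiv ℝ (f : Module.Dual ℝ V → ℝ)) ξ :=
    ((f.contDiff.fderiv_right (m := ∞) (by simp)).differentiable (by simp)) ξ
  have h (i j : Fin (Module.finrank ℝ V)) : partialDeriv i (partialDeriv j f) ξ =
      fderiv ℝ (fderiv ℝ (f : Module.Dual ℝ V → ℝ)) ξ ((Module.finBasis ℝ V).coord i)
        ((Module.finBasis ℝ V).coord j) := by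
    rw [partialDeriv_apply]
    change fderiv ℝ (fun ξ => fderiv ℝ (f : Module.Dual ℝ V → ℝ) ξ
      ((Module.finBasis ℝ V).coord j)) ξ _ = _
    rw [fderiv_clm_apply hd (differentiableAt_const _)]
    simp
  rw [h, h]
  exact (f.contDiff.contDiffAt.isSymmSndFDerivAt (by
    rw [minSmoothness_of_isRCLikeNormedField]
    exact WithTop.coe_le_coe.2 (le_top : (2 : ℕ∞) ≤ ⊤))) _ _

variable (V) in
/-- The operators `D` on `C^∞(V^*)` of the form `f ↦ ∑ᵢ D(xᵢ) ∂ᵢ f`, that is, the smooth vector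
fields viewed as operators. -/
def firstOrder : Submodule ℝ (Module.End ℝ (SmoothFun V)) where
  carrier := {D | ∀ f, D f = ∑ i, D (linearFun (Module.finBasis ℝ V i)) * partialDeriv i f}
  add_mem' {D E} hD hE f := by
    rw [LinearMap.add_apply, hD, hE, ← Finset.sum_add_distrib]
    simp only [LinearMap.add_apply, add_mul]
  zero_mem' f := by simp
  smul_mem' r D hD f := by
    rw [LinearMap.smul_apply, hD, Finset.smul_sum]
    simp only [LinearMap.smul_apply, smul_mul_assoc]

theorem ext_of_mem_firstOrder {D E : Module.End ℝ (SmoothFun V)} (hD : D ∈ firstOrder V)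
    (hE : E ∈ firstOrder V) (h : ∀ X, D (linearFun X) = E (linearFun X)) : D = E := by
  ext f : 1
  rw [hD f, hE f]
  simp only [h]

theorem map_mul_of_mem_firstOrder {D : Module.End ℝ (SmoothFun V)} (hD : D ∈ firstOrder V)
    (f g : SmoothFun V) : D (f * g) = f * D g + g * D f := by
  rw [hD (f * g), hD f, hD g, Finset.mul_sum, Finset.mul_sum, ← Finset.sum_add_distrib]
  refine Finset.sum_congr rfl fun i _ => ?_
  rw [partialDeriv_mul]
  ring

theorem VectorField.act_mem_firstOrder (Z : VectorField V) : Z.act ∈ firstOrder V := by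
  intro f
  ext ξ
  have h : Z.toFun ξ = ∑ i, Z.toFun ξ (Module.finBasis ℝ V i) • (Module.finBasis ℝ V).coord i :=
    ((Module.finBasis ℝ V).sum_dual_apply_smul_coord (Z.toFun ξ)).symm
  rw [VectorField.act_apply]
  conv_lhs => rw [h]
  rw [map_sum]
  simp only [map_smul, smul_eq_mul]
  rw [sum_mul_apply]
  exact Finset.sum_congr rfl fun i _ => by rw [VectorField.act_linearFun_apply, partialDeriv_apply]

theorem commutator_mem_firstOrder {D E : Module.End ℝ (SmoothFun V)} (hD : D ∈ firstOrder V)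
    (hE : E ∈ firstOrder V) : D * E - E * D ∈ firstOrder V := by
  intro f
  have key {D E : Module.End ℝ (SmoothFun V)} (hD : D ∈ firstOrder V) (hE : E ∈ firstOrder V) :
      D (E f) = ∑ i, D (E (linearFun (Module.finBasis ℝ V i))) * partialDeriv i f +
        ∑ i, ∑ j, E (linearFun (Module.finBasis ℝ V i)) * D (linearFun (Module.finBasis ℝ V j)) *
          partialDeriv j (partialDeriv i f) := by
    conv_lhs => rw [hE f, map_sum]
    rw [← Finset.sum_add_distrib]
    refine Finset.sum_congr rfl fun i _ => ?_
    rw [map_mul_of_mem_firstOrder hD, hD (partialDeriv i f), Finset.mul_sum, add_comm, mul_comm]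
    congr 1
    exact Finset.sum_congr rfl fun j _ => by rw [mul_assoc]
  simp only [LinearMap.sub_apply, Module.End.mul_apply, sub_mul, Finset.sum_sub_distrib]
  rw [key hD hE, key hE hD, Finset.sum_comm (γ := Fin (Module.finrank ℝ V))]
  rw [add_sub_add_comm, add_eq_left, sub_eq_zero]
  refine Finset.sum_congr rfl fun i _ => Finset.sum_congr rfl fun j _ => ?_
  rw [partialDeriv_comm, mul_comm (E _)]

theorem BivectorField.bracket_eq_sum (B : BivectorField V) (f g : SmoothFun V) :
    B.bracket f g = ∑ i, B.bracket f (linearFun (Module.finBasis ℝ V i)) * partialDeriv i g := by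
  ext ξ
  rw [sum_mul_apply]
  simp only [BivectorField.bracket_apply, differential_linearFun, partialDeriv_apply]
  conv_lhs => rw [differential_eq_sum g, map_sum]
  exact Finset.sum_congr rfl fun i _ => by rw [map_smul, smul_eq_mul, mul_comm]

theorem BivectorField.bracket_self (B : BivectorField V) (f : SmoothFun V) :
    B.bracket f f = 0 := by
  ext ξ
  exact B.isAlt ξ _

end Operators

/-! ### Polynomial bivector fields -/

section Polynomial

variable {V : Type*} [AddCommGroup V] [Module ℝ V] [FiniteDimensional ℝ V]

theorem linearFun_mem_polynomialFun (X : V) : linearFun X ∈ polynomialFun V :=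
  Algebra.subset_adjoin ⟨X, rfl⟩

/-- A vector field with polynomial coefficients. -/
def VectorField.IsPolynomial (Z : VectorField V) : Prop :=
  ∀ X, Z.act (linearFun X) ∈ polynomialFun V

theorem VectorField.isPolynomial_zero : (0 : VectorField V).IsPolynomial := fun X => by
  rw [VectorField.act_zero, LinearMap.zero_apply]
  exact zero_mem _

theorem VectorField.act_algebraMap (Z : VectorField V) (r : ℝ) :
    Z.act (algebraMap ℝ (SmoothFun V) r) = 0 := by
  have h1 : Z.act 1 = 0 := by simpa using Z.act_mul 1 1
  rw [Algebra.algebraMap_eq_smul_one, map_smul, h1, smul_zero]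

theorem VectorField.IsPolynomial.act_mem {Z : VectorField V} (hZ : Z.IsPolynomial)
    {p : SmoothFun V} (hp : p ∈ polynomialFun V) : Z.act p ∈ polynomialFun V := by
  have hp' := hp
  induction hp using Algebra.adjoin_induction with
  | mem p h =>
    obtain ⟨X, rfl⟩ := h
    exact hZ X
  | algebraMap r =>
    rw [Z.act_algebraMap]
    exact zero_mem _
  | add p q hp hq ihp ihq =>
    rw [map_add]
    exact add_mem (ihp hp) (ihq hq)
  | mul p q hp hq ihp ihq =>
    rw [Z.act_mul]
    exact add_mem (mul_mem hp (ihq hq)) (mul_mem hq (ihp hp))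

variable (V) in
/-- The bilinear operators given by polynomial bivector fields: those which are alternating,
are vector fields in the second (hence in each) argument, and preserve polynomials. -/
def polynomialBivector : Submodule ℝ (BilinOp V) where
  carrier := {B | (∀ f, B f ∈ firstOrder V) ∧ (∀ f, B f f = 0) ∧
    ∀ p ∈ polynomialFun V, ∀ q ∈ polynomialFun V, B p q ∈ polynomialFun V}
  add_mem' {B C} hB hC := by
    refine ⟨fun f => add_mem (hB.1 f) (hC.1 f), fun f => ?_, fun p hp q hq =>
      add_mem (hB.2.2 p hp q hq) (hC.2.2 p hp q hq)⟩
    rw [LinearMap.add_apply, LinearMap.add_apply, hB.2.1, hC.2.1, add_zero]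
  zero_mem' := ⟨fun f => zero_mem _, fun f => rfl, fun p _ q _ => zero_mem _⟩
  smul_mem' r B hB := by
    refine ⟨fun f => Submodule.smul_mem _ r (hB.1 f), fun f => ?_, fun p hp q hq =>
      Subalgebra.smul_mem _ (hB.2.2 p hp q hq) r⟩
    rw [LinearMap.smul_apply, LinearMap.smul_apply, hB.2.1, smul_zero]

theorem neg_apply_swap_of_mem {B : BilinOp V} (hB : B ∈ polynomialBivector V)
    (f g : SmoothFun V) : -B f g = B g f := by
  have h := hB.2.1 (f + g)
  simp only [map_add, LinearMap.add_apply, hB.2.1, zero_add, add_zero] at h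
  rwa [neg_eq_iff_add_eq_zero, add_comm]

theorem ext_of_mem_polynomialBivector {B C : BilinOp V} (hB : B ∈ polynomialBivector V)
    (hC : C ∈ polynomialBivector V)
    (h : ∀ X Y, B (linearFun X) (linearFun Y) = C (linearFun X) (linearFun Y)) : B = C := by
  ext f : 1
  refine ext_of_mem_firstOrder (hB.1 f) (hC.1 f) fun Y => ?_
  rw [← neg_apply_swap_of_mem hB, ← neg_apply_swap_of_mem hC,
    ext_of_mem_firstOrder (hB.1 (linearFun Y)) (hC.1 (linearFun Y)) (h Y)]

theorem lieAct_mem_polynomialBivector {Z : VectorField V} (hZ : Z.IsPolynomial) {B : BilinOp V}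
    (hB : B ∈ polynomialBivector V) : lieAct Z B ∈ polynomialBivector V := by
  refine ⟨fun f => ?_, fun f => ?_, fun p hp q hq => ?_⟩
  · have h : lieAct Z B f = (Z.act * B f - B f * Z.act) - B (Z.act f) := by
      ext g : 1
      simp only [lieAct_apply, LinearMap.sub_apply, Module.End.mul_apply]
      abel
    rw [h]
    exact sub_mem (commutator_mem_firstOrder Z.act_mem_firstOrder (hB.1 f)) (hB.1 _)
  · rw [lieAct_apply, hB.2.1, map_zero, ← neg_apply_swap_of_mem hB f]
    simp
  · rw [lieAct_apply]
    exact sub_mem (sub_mem (hZ.act_mem (hB.2.2 p hp q hq)) (hB.2.2 _ (hZ.act_mem hp) q hq))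
      (hB.2.2 p hp _ (hZ.act_mem hq))

theorem expAct_mem_polynomialBivector {Z : ℕ → VectorField V} (hZ : ∀ i, (Z i).IsPolynomial)
    {B : ℕ → BilinOp V} (hB : ∀ i, B i ∈ polynomialBivector V) (n : ℕ) :
    expAct Z B n ∈ polynomialBivector V := by
  have h (k : ℕ) : ∀ i, (formalLieAct Z)^[k] B i ∈ polynomialBivector V := by
    induction k with
    | zero => simpa using hB
    | succ k ih =>
      intro i
      rw [Function.iterate_succ_apply']
      exact sum_mem fun p _ => lieAct_mem_polynomialBivector (hZ p.1) (ih p.2)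
  exact sum_mem fun k _ => Submodule.smul_mem _ _ (h k n)

theorem bracket_mem_polynomialBivector {β : ℕ → BivectorField V} (hβ : IsAlgebraic β) (i : ℕ) :
    (β i).bracket ∈ polynomialBivector V :=
  ⟨fun f g => (β i).bracket_eq_sum f g, (β i).bracket_self, hβ i⟩

/-- The vector field with prescribed values `φ(X)` on the linear functions `X`. -/
def VectorField.ofLinearMap (φ : V →ₗ[ℝ] SmoothFun V) : VectorField V where
  toFun ξ := ∑ i, φ (Module.finBasis ℝ V i) ξ • (Module.finBasis ℝ V).coord i
  contDiff_toFun := ContDiff.sum fun i _ =>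
    (φ (Module.finBasis ℝ V i)).contDiff.smul contDiff_const

theorem VectorField.ofLinearMap_act_linearFun (φ : V →ₗ[ℝ] SmoothFun V) (X : V) :
    (VectorField.ofLinearMap φ).act (linearFun X) = φ X := by
  ext ξ
  conv_rhs => rw [← (Module.finBasis ℝ V).sum_repr X, map_sum]
  rw [VectorField.act_linearFun_apply]
  simp only [ofLinearMap, LinearMap.sum_apply, LinearMap.smul_apply, Module.Basis.coord_apply,
    smul_eq_mul, map_smul]
  refine Eq.trans ?_ (map_sum (ContMDiffMap.evalRingHom (n := ∞) ξ) (fun i => _) _).symm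
  exact Finset.sum_congr rfl fun i _ => mul_comm _ _

variable (V) in
/-- The polynomial functions of degree at most `k`. -/
def polynomialFunLE (k : ℕ) : Submodule ℝ (SmoothFun V) :=
  (1 ⊔ LinearMap.range (linearFunₗ V)) ^ k

instance (k : ℕ) : FiniteDimensional ℝ (polynomialFunLE V k) := by
  rw [← Submodule.fg_iff_finiteDimensional]
  refine Submodule.FG.pow (Submodule.FG.sup ?_ ?_) k
  · rw [Submodule.one_eq_span]
    exact Submodule.fg_span_singleton 1
  · rw [Submodule.fg_iff_finiteDimensional]
    infer_instance

theorem polynomialFunLE_mono {k l : ℕ} (h : k ≤ l) : polynomialFunLE V k ≤ polynomialFunLE V l :=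
  pow_le_pow_right₀ le_sup_left h

theorem exists_mem_polynomialFunLE {p : SmoothFun V} (hp : p ∈ polynomialFun V) :
    ∃ k, p ∈ polynomialFunLE V k := by
  induction hp using Algebra.adjoin_induction with
  | mem p h =>
    obtain ⟨X, rfl⟩ := h
    refine ⟨1, ?_⟩
    rw [polynomialFunLE, pow_one]
    exact Submodule.mem_sup_right ⟨X, rfl⟩
  | algebraMap r => exact ⟨0, by rw [polynomialFunLE, pow_zero]; exact Submodule.algebraMap_mem r⟩
  | add p q _ _ ihp ihq =>
    obtain ⟨k, hk⟩ := ihp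
    obtain ⟨l, hl⟩ := ihq
    exact ⟨max k l, add_mem (polynomialFunLE_mono (le_max_left k l) hk)
      (polynomialFunLE_mono (le_max_right k l) hl)⟩
  | mul p q _ _ ihp ihq =>
    obtain ⟨k, hk⟩ := ihp
    obtain ⟨l, hl⟩ := ihq
    refine ⟨k + l, ?_⟩
    rw [polynomialFunLE, pow_add]
    exact Submodule.mul_mem_mul hk hl

theorem polynomialFunLE_le (k : ℕ) :
    polynomialFunLE V k ≤ Subalgebra.toSubmodule (polynomialFun V) := by
  have h : 1 ⊔ LinearMap.range (linearFunₗ V) ≤ Subalgebra.toSubmodule (polynomialFun V) := by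
    refine sup_le ?_ ?_
    · rw [Submodule.one_le]
      exact one_mem (polynomialFun V)
    · rintro _ ⟨X, rfl⟩
      exact linearFun_mem_polynomialFun X
  induction k with
  | zero =>
    rw [polynomialFunLE, pow_zero, Submodule.one_le]
    exact one_mem (polynomialFun V)
  | succ k ih =>
    rw [polynomialFunLE, pow_succ, Submodule.mul_le]
    exact fun p hp q hq => (polynomialFun V).mul_mem (ih hp) (h hq)

/-- A first-order operator that sends linear functions to linear functions does not raise the
degree of polynomials. -/
theorem map_mem_polynomialFunLE {D : Module.End ℝ (SmoothFun V)} (hD : D ∈ firstOrder V)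
    (hlin : ∀ X, D (linearFun X) ∈ LinearMap.range (linearFunₗ V)) (k : ℕ) {p : SmoothFun V}
    (hp : p ∈ polynomialFunLE V k) : D p ∈ polynomialFunLE V k := by
  have hone : D 1 = 0 := by simpa using map_mul_of_mem_firstOrder hD 1 1
  have hW {w : SmoothFun V} (hw : w ∈ 1 ⊔ LinearMap.range (linearFunₗ V)) :
      D w ∈ 1 ⊔ LinearMap.range (linearFunₗ V) := by
    obtain ⟨a, ha, b, ⟨X, rfl⟩, rfl⟩ := Submodule.mem_sup.1 hw
    obtain ⟨r, rfl⟩ := Submodule.mem_one.1 ha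
    rw [map_add, Algebra.algebraMap_eq_smul_one, map_smul, hone, smul_zero, zero_add]
    exact Submodule.mem_sup_right (hlin X)
  induction k generalizing p with
  | zero =>
    rw [polynomialFunLE, pow_zero] at hp
    obtain ⟨r, rfl⟩ := Submodule.mem_one.1 hp
    rw [Algebra.algebraMap_eq_smul_one, map_smul, hone, smul_zero]
    exact zero_mem _
  | succ k ih =>
    rw [polynomialFunLE, pow_succ] at hp ⊢
    induction hp using Submodule.mul_induction_on' with
    | mem_mul_mem a ha b hb =>
      rw [map_mul_of_mem_firstOrder hD, mul_comm b]
      exact add_mem (Submodule.mul_mem_mul ha (hW hb)) (Submodule.mul_mem_mul (ih ha) hb)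
    | add a _ b _ iha ihb =>
      rw [map_add]
      exact add_mem iha ihb

/-- An operator on `V × V` with polynomial values has values of bounded degree. -/
theorem exists_forall_mem_polynomialFunLE (T : V →ₗ[ℝ] V →ₗ[ℝ] SmoothFun V)
    (hT : ∀ X Y, T X Y ∈ polynomialFun V) : ∃ k, ∀ X Y, T X Y ∈ polynomialFunLE V k := by
  let b := Module.finBasis ℝ V
  choose k hk using fun p : Fin (Module.finrank ℝ V) × Fin (Module.finrank ℝ V) =>
    exists_mem_polynomialFunLE (hT (b p.1) (b p.2))
  refine ⟨Finset.univ.sup k, fun X Y => ?_⟩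
  rw [← b.sum_repr X, ← b.sum_repr Y]
  simp only [map_sum, map_smul, LinearMap.sum_apply, LinearMap.smul_apply]
  exact sum_mem fun i _ => Submodule.smul_mem _ _ (sum_mem fun j _ => Submodule.smul_mem _ _
    (polynomialFunLE_mono (Finset.le_sup (Finset.mem_univ (_, _))) (hk (_, _))))

end Polynomial

/-! ### The Poisson cohomology of `𝔤^*` -/

section Kirillov

variable {𝔤 : Type*} [LieRing 𝔤] [LieAlgebra ℝ 𝔤] [FiniteDimensional ℝ 𝔤]

theorem kirillov_bracket_linearFun (X Y : 𝔤) :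
    (kirillov 𝔤).bracket (linearFun X) (linearFun Y) = linearFun ⁅X, Y⁆ := by
  ext ξ
  rw [BivectorField.bracket_apply, differential_linearFun, differential_linearFun]
  rfl

theorem kirillov_bracket_mem_firstOrder (f : SmoothFun 𝔤) :
    (kirillov 𝔤).bracket f ∈ firstOrder 𝔤 := (kirillov 𝔤).bracket_eq_sum f

/-- The action of `𝔤` on `C^∞(𝔤^*)` by Hamiltonian vector fields of linear functions, which is the
infinitesimal coadjoint action. -/
instance : LieRingModule 𝔤 (SmoothFun 𝔤) where
  bracket X f := (kirillov 𝔤).bracket (linearFun X) f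
  add_lie X Y f := by
    simp only [← linearFunₗ_apply, map_add, LinearMap.add_apply]
  lie_add X f g := map_add _ f g
  leibniz_lie X Y f := by
    have h := ext_of_mem_firstOrder
      (commutator_mem_firstOrder (kirillov_bracket_mem_firstOrder (linearFun X))
        (kirillov_bracket_mem_firstOrder (linearFun Y)))
      (kirillov_bracket_mem_firstOrder (linearFun ⁅X, Y⁆)) fun W => by
        simp only [LinearMap.sub_apply, Module.End.mul_apply, kirillov_bracket_linearFun]
        simp only [← linearFunₗ_apply, ← map_sub, lie_lie]
    rw [← sub_eq_iff_eq_add]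
    exact LinearMap.congr_fun h f

theorem lie_def (X : 𝔤) (f : SmoothFun 𝔤) : ⁅X, f⁆ = (kirillov 𝔤).bracket (linearFun X) f := rfl

instance : LieModule ℝ 𝔤 (SmoothFun 𝔤) where
  smul_lie r X f := by
    simp only [lie_def, ← linearFunₗ_apply, map_smul, LinearMap.smul_apply]
  lie_smul r X f := map_smul _ r f

variable (𝔤) in
/-- The polynomials of degree at most `k` as a finite-dimensional `𝔤`-module. -/
def polynomialLieSubmodule (k : ℕ) : LieSubmodule ℝ 𝔤 (SmoothFun 𝔤) where
  toSubmodule := polynomialFunLE 𝔤 k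
  lie_mem {X _} hf := map_mem_polynomialFunLE (kirillov_bracket_mem_firstOrder (linearFun X))
    (fun Y => ⟨⁅X, Y⁆, (kirillov_bracket_linearFun X Y).symm⟩) k hf

instance (k : ℕ) : FiniteDimensional ℝ (polynomialLieSubmodule 𝔤 k) :=
  inferInstanceAs (FiniteDimensional ℝ (polynomialFunLE 𝔤 k))

/-- Polynomial bivector fields that are closed for the Poisson differential `[β₀, ·]` are exact: the
second Poisson cohomology of `𝔤^*` with polynomial coefficients vanishes. -/
theorem exists_add_lieAct_kirillov_eq_zero [LieAlgebra.IsKilling ℝ 𝔤] {B : BilinOp 𝔤}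
    (hB : B ∈ polynomialBivector 𝔤)
    (hπ : (kirillov 𝔤).bracket ∈ polynomialBivector 𝔤)
    (hJ : jacobiator (kirillov 𝔤).bracket B + jacobiator B (kirillov 𝔤).bracket = 0) :
    ∃ Z : VectorField 𝔤, Z.IsPolynomial ∧ B + lieAct Z (kirillov 𝔤).bracket = 0 := by
  -- The values of `B` on linear functions form a 2-cocycle of `𝔤`.
  let T : 𝔤 →ₗ[ℝ] 𝔤 →ₗ[ℝ] SmoothFun 𝔤 := B.compl₁₂ (linearFunₗ 𝔤) (linearFunₗ 𝔤)
  obtain ⟨k, hk⟩ := exists_forall_mem_polynomialFunLE T fun X Y =>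
    hB.2.2 _ (linearFun_mem_polynomialFun X) _ (linearFun_mem_polynomialFun Y)
  let N := polynomialLieSubmodule 𝔤 k
  let c : LieModule.Cohomology.twoCochain ℝ 𝔤 N :=
    ⟨LinearMap.mk₂ ℝ (fun X Y => (⟨T X Y, hk X Y⟩ : N))
      (fun _ _ _ => Subtype.ext (by simp)) (fun _ _ _ => Subtype.ext (by simp))
      (fun _ _ _ => Subtype.ext (by simp)) (fun _ _ _ => Subtype.ext (by simp)),
      fun X => Subtype.ext (hB.2.1 (linearFun X))⟩
  have hc : c ∈ LieModule.Cohomology.twoCocycle ℝ 𝔤 N := by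
    rw [LieModule.Cohomology.mem_twoCocycle_iff]
    ext X Y W : 3
    rw [LieModule.Cohomology.d₂₃_apply]
    refine Subtype.ext ?_
    change ⁅X, B (linearFun Y) (linearFun W)⁆ - ⁅Y, B (linearFun X) (linearFun W)⁆
      + ⁅W, B (linearFun X) (linearFun Y)⁆ - B (linearFun ⁅X, Y⁆) (linearFun W)
      + B (linearFun ⁅X, W⁆) (linearFun Y) - B (linearFun ⁅Y, W⁆) (linearFun X) = 0
    have h := congrFun (congrFun (congrFun hJ (linearFun X)) (linearFun Y)) (linearFun W)
    simp only [Pi.add_apply, Pi.zero_apply, jacobiator_apply, kirillov_bracket_linearFun] at h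
    have e : linearFun ⁅X, W⁆ = -linearFun ⁅W, X⁆ := by
      simp only [← linearFunₗ_apply, ← map_neg, lie_skew]
    rw [← neg_apply_swap_of_mem hB (linearFun X) (linearFun W), map_neg,
      ← neg_apply_swap_of_mem hB (linearFun ⁅W, X⁆) (linearFun Y),
      ← neg_apply_swap_of_mem hB (linearFun ⁅Y, W⁆) (linearFun X),
      ← neg_apply_swap_of_mem hB (linearFun ⁅X, Y⁆) (linearFun W)] at h
    simp only [lie_def]
    rw [← h, e, map_neg, LinearMap.neg_apply]
    abel
  obtain ⟨φ, hφ⟩ :=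
    LieModule.Cohomology.exists_d₁₂_eq_of_mem_twoCocycle ℝ 𝔤 _ N rfl c hc
  let φ' : 𝔤 →ₗ[ℝ] SmoothFun 𝔤 := N.toSubmodule.subtype ∘ₗ φ
  have hZ : (VectorField.ofLinearMap φ').IsPolynomial := fun X => by
    rw [VectorField.ofLinearMap_act_linearFun]
    exact polynomialFunLE_le k (φ X).2
  refine ⟨VectorField.ofLinearMap φ', hZ, ?_⟩
  refine ext_of_mem_polynomialBivector (add_mem hB (lieAct_mem_polynomialBivector hZ hπ))
    (zero_mem _) fun X Y => ?_
  have h : ⁅X, φ' Y⁆ - ⁅Y, φ' X⁆ - φ' ⁅X, Y⁆ = B (linearFun X) (linearFun Y) :=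
    congrArg (fun a : LieModule.Cohomology.twoCochain ℝ 𝔤 N => ((a X Y : N) : SmoothFun 𝔤)) hφ
  simp only [LinearMap.add_apply, LinearMap.zero_apply, lieAct_apply, kirillov_bracket_linearFun,
    VectorField.ofLinearMap_act_linearFun]
  rw [← neg_apply_swap_of_mem hπ (linearFun Y), ← lie_def, ← lie_def, ← h]
  abel

/-! ### Removing the deformation order by order -/

/-- The leading coefficient of a formal deformation of the Kirillov bracket is closed for the
Poisson differential. -/
theorem jacobiator_add_jacobiator_eq_zero {B : ℕ → BilinOp 𝔤} (hB : formalJacobiator B B = 0)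
    {n : ℕ} (hn : n ≠ 0) (hlt : ∀ m < n, m ≠ 0 → B m = 0) :
    jacobiator (B 0) (B n) + jacobiator (B n) (B 0) = 0 := by
  have h := congrFun hB n
  rw [formalJacobiator, Finset.sum_eq_add_of_mem (0, n) (n, 0) (by simp) (by simp)
    (by simp [hn.symm])] at h
  · exact h
  · rintro ⟨i, j⟩ hp ⟨h1, h2⟩
    rw [mem_antidiagonal] at hp
    simp only [ne_eq, Prod.mk.injEq, not_and] at h1 h2 hp
    rw [hlt i (by omega) (by omega), map_zero, LinearMap.zero_apply]

end Kirillov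

/-- Given a gauge transformation that trivializes `β` below order `n`, the coefficient `Zₙ` can be
chosen to trivialize it at order `n` as well. -/
theorem exists_update_expAct_eq {𝔤 : Type*} [LieRing 𝔤] [LieAlgebra ℝ 𝔤]
    [FiniteDimensional ℝ 𝔤] [LieAlgebra.IsKilling ℝ 𝔤] {β : ℕ → BivectorField 𝔤}
    (hPoisson : IsFormalPoisson β) (hAlgebraic : IsAlgebraic β) (hβ₀ : β 0 = kirillov 𝔤)
    {Z : ℕ → VectorField 𝔤} (hZ : Z 0 = 0) (hpoly : ∀ i, (Z i).IsPolynomial) {n : ℕ} (hn : n ≠ 0)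
    (hZn : Z n = 0) (hlt : ∀ m < n, m ≠ 0 → expAct Z (fun i => (β i).bracket) m = 0) :
    ∃ W : VectorField 𝔤, W.IsPolynomial ∧
      expAct (Function.update Z n W) (fun i => (β i).bracket) n = 0 := by
  have hJ := jacobiator_add_jacobiator_eq_zero
    (formalJacobiator_expAct hZ ((isFormalPoisson_iff β).1 hPoisson)) hn hlt
  have hπ := bracket_mem_polynomialBivector hAlgebraic 0
  rw [expAct_zero] at hJ
  rw [hβ₀] at hJ hπ
  obtain ⟨W, hW, h⟩ := exists_add_lieAct_kirillov_eq_zero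
    (expAct_mem_polynomialBivector hpoly (bracket_mem_polynomialBivector hAlgebraic) n) hπ hJ
  refine ⟨W, hW, ?_⟩
  rw [expAct_eq_add_lieAct hZ (by rw [Function.update_of_ne hn.symm, hZ]) hn
    (fun i hi => (Function.update_of_ne hi.ne _ _).symm) hZn, Function.update_self, hβ₀, h]

end

end KirillovDeformation

theorem mainTheorem3 (𝔤 : Type*) [LieRing 𝔤] [LieAlgebra ℝ 𝔤] [FiniteDimensional ℝ 𝔤]
    [LieAlgebra.IsSemisimple ℝ 𝔤]
    (β : ℕ → KirillovDeformation.BivectorField 𝔤)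
    (hPoisson : KirillovDeformation.IsFormalPoisson β)
    (hAlgebraic : KirillovDeformation.IsAlgebraic β)
    (hβ₀ : β 0 = KirillovDeformation.kirillov 𝔤) :
    KirillovDeformation.GaugeEquivalent β
      (fun i => if i = 0 then KirillovDeformation.kirillov 𝔤 else 0) := by
  open KirillovDeformation in
  let b : ℕ → BilinOp 𝔤 := fun i => (β i).bracket
  -- The partial gauge transformations `Z₁ h + ⋯ + Zₙ hⁿ` that trivialize `β` up to order `n`.
  let S (n : ℕ) := {Z : ℕ → VectorField 𝔤 // (Z 0 = 0 ∧ (∀ i, (Z i).IsPolynomial) ∧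
    ∀ i, n < i → Z i = 0) ∧ ∀ m ≤ n, m ≠ 0 → expAct Z b m = 0}
  have step (n : ℕ) (Z : S n) : ∃ Z' : S (n + 1), ∀ i ≤ n, Z'.1 i = Z.1 i := by
    obtain ⟨Z, ⟨hZ, hpoly, hsupp⟩, hlt⟩ := Z
    obtain ⟨W, hW, h⟩ := exists_update_expAct_eq hPoisson hAlgebraic hβ₀ hZ hpoly n.succ_ne_zero
      (hsupp _ n.lt_succ_self) fun m hm => hlt m (Nat.le_of_lt_succ hm)
    have hagree (i : ℕ) (hi : i ≤ n) : Function.update Z (n + 1) W i = Z i :=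
      Function.update_of_ne (by omega) _ _
    have hZ' : Function.update Z (n + 1) W 0 = 0 := (hagree 0 n.zero_le).trans hZ
    refine ⟨⟨Function.update Z (n + 1) W, ⟨hZ', fun i => ?_, fun i hi => ?_⟩,
      fun m hm hm0 => ?_⟩, hagree⟩
    · rcases eq_or_ne i (n + 1) with rfl | hi
      · rwa [Function.update_self]
      · rw [Function.update_of_ne hi]
        exact hpoly i
    · rw [Function.update_of_ne (by omega)]
      exact hsupp i (by omega)
    · rcases Nat.le_succ_iff.1 hm with hm | rfl
      · rw [expAct_congr hZ' hZ fun i hi => hagree i (hi.trans hm)]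
        exact hlt m hm hm0
      · exact h
  choose next hnext using step
  let Z₀ : S 0 := ⟨fun _ => 0, ⟨rfl, fun _ => VectorField.isPolynomial_zero, fun _ _ => rfl⟩,
    fun m hm hm0 => absurd (Nat.le_zero.1 hm) hm0⟩
  let Y (n : ℕ) : S n := Nat.rec Z₀ next n
  have hY (n k : ℕ) : ∀ i ≤ n, (Y (n + k)).1 i = (Y n).1 i := by
    induction k with
    | zero => exact fun _ _ => rfl
    | succ k ih => exact fun i hi => (hnext (n + k) (Y (n + k)) i (by omega)).trans (ih i hi)
  have hdiag (n i : ℕ) (hi : i ≤ n) : (Y i).1 i = (Y n).1 i := by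
    obtain ⟨k, rfl⟩ := Nat.exists_eq_add_of_le hi
    exact (hY i k i le_rfl).symm
  refine ⟨fun n => (Y n).1 n, rfl, funext fun n => ?_⟩
  rcases eq_or_ne n 0 with rfl | hn
  · rw [expAct_zero, hβ₀]
    rfl
  · rw [expAct_congr (Z' := (Y n).1) rfl (Y n).2.1.1 (hdiag n), (Y n).2.2 n le_rfl hn]
    dsimp only
    rw [if_neg hn]
    rfl
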